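/- Theorem (Convergence rate, $p>1$). Let $X_1,X_2,\ldots$ be i.i.d. real observations from a probability measure $P_0$ on $\mathbb R$ with Lebesgue density $p_0$. Let $\mathcal F$ be a collection of probability densities on $\mathbb R$, where a density $p$ is identified with its probability measure $P$, equipped with the Borel $\sigma$-algebra of the weak topology; assume that the densities are chosen so that $(p,x)\mapsto p(x)$ is jointly measurable. For every $n$ let $\Pi_n$ be a probability measure on $\mathcal F$ (the prior, which may depend on $n$), and let $$\Pi_n(A\mid X_1,\ldots,X_n)=\frac{\int_A\prod_{i=1}^n \frac{p(X_i)}{p_0(X_i)}\,d\Pi_n(p)}{\int_{\mathcal F}\prod_{i=1}^n \frac{p(X_i)}{p_0(X_i)}\,d\Pi_n(p)}$$ be the posterior probability of $A\subset\mathcal F$. For $q>0$ write $M_q(P)=\int|x|^q\,dP(x)$, and for $r\ge 1$ let $$W_r(P,Q)=\inf_{\pi}\Big(\int_{\mathbb R^2}|x-y|^r\,d\pi(x,y)\Big)^{1/r}$$ be the Wasserstein metric of order $r$, where the infimum is over all couplings $\pi$ of $P$ and $Q$, i.e. Borel probability measures on $\mathbb R^2$ with marginals $P$ and $Q$. Let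 $r>1$. Let $(\epsilon_n)_{n\ge1}$ be a nonincreasing real sequence with $\epsilon_n\to0$ and $\epsilon_n\ge\sqrt{(\log n)/n}$ for all $n\ge 1$, and suppose that for all large enough $n$ $$\Pi_n(\mathcal K_n)\ge e^{-n\epsilon_n^2},\qquad \mathcal K_n=\Big\{p\in\mathcal F:\ \int\log\frac{p_0}{p}\,dP_0\le\epsilon_n^2,\ \int\Big(\log\frac{p_0}{p}\Big)^2dP_0\le\epsilon_n^2\Big\},$$ with the convention $\log(p_0/p)=+\infty$ where $p=0<p_0$. Assume moreover that there are constants $K>0$ and $\delta>0$ such that $M_{2r+\delta}(P_0)<\infty$ and $$\Pi_n\big(M_{2r+\delta}(P)\le K\mid X_1,\ldots,X_n\big)\longrightarrow 1\quad\text{in probability}.$$ Then there is a constant $K'>0$ such that $$\Pi_n\big(W_r^r(P,P_0)\ge K'\epsilon_n\mid X_1,\ldots,X_n\big)\longrightarrow 0\quad\text{in probability}.$$ Convergence in probability is with respect to the true distribution, under which the $X_i$ are i.i.d. from $P_0$. -/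

import Mathlib

open MeasureTheory ProbabilityTheory Filter Topology
open scoped NNReal ENNReal

noncomputable section

namespace WassersteinPosterior

/-- The absolute moment `M_q(P) = ∫ |x|^q dP(x)` of a measure on the line, with values in
`[0, ∞]`. -/
def absMoment (q : ℝ) (P : Measure ℝ) : ℝ≥0∞ :=
  ∫⁻ x, ENNReal.ofReal (|x| ^ q) ∂P

/-- The couplings of `P` and `Q`: Borel measures on the plane with marginals `P` and `Q`
(when `P` and `Q` are probability measures, so is every coupling). -/
def couplings (P Q : Measure ℝ) : Set (Measure (ℝ × ℝ)) :=
  {γ | γ.map Prod.fst = P ∧ γ.map Prod.snd = Q}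

/-- The Wasserstein metric of order `p`, with values in `[0, ∞]`:
`W_p(P, Q) = inf_γ (∫ |x - y|^p dγ(x, y))^(1/p)` over the couplings `γ` of `P` and `Q`. -/
def wasserstein (p : ℝ) (P Q : Measure ℝ) : ℝ≥0∞ :=
  ⨅ γ ∈ couplings P Q, (∫⁻ z, ENNReal.ofReal (|z.1 - z.2| ^ p) ∂γ) ^ (1 / p)

/-- The function `f` is a density (with respect to Lebesgue measure) of the measure `P`. -/
def IsDensity (f : ℝ → ℝ≥0) (P : Measure ℝ) : Prop :=
  Measurable f ∧ P = volume.withDensity (fun x => (f x : ℝ≥0∞))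

/-- The Kullback--Leibler type neighbourhood
`{θ : ∫ log (p₀ / p_θ) dP₀ ≤ ε², ∫ (log (p₀ / p_θ))² dP₀ ≤ ε²}` in a family of densities
`(p_θ)`. Where `p_θ = 0` the value of `log (p₀ / p_θ)` is `+∞`, so membership requires
`p_θ > 0` almost everywhere under `P₀`, and both integrals have to exist and be finite. -/
def klNeighborhood {Θ : Type*} (P₀ : Measure ℝ) (p₀ : ℝ → ℝ≥0) (dens : Θ → ℝ → ℝ≥0) (ε : ℝ) :
    Set Θ :=
  {θ | (∀ᵐ x ∂P₀, 0 < dens θ x) ∧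
    Integrable (fun x => Real.log ((p₀ x : ℝ) / dens θ x)) P₀ ∧
    Integrable (fun x => Real.log ((p₀ x : ℝ) / dens θ x) ^ 2) P₀ ∧
    ∫ x, Real.log ((p₀ x : ℝ) / dens θ x) ∂P₀ ≤ ε ^ 2 ∧
    ∫ x, Real.log ((p₀ x : ℝ) / dens θ x) ^ 2 ∂P₀ ≤ ε ^ 2}

/-- The likelihood ratio `∏ p_θ(x_i) / p₀(x_i)` of the observations `x_1, …, x_n`. -/
def likelihoodRatio {Θ : Type*} (p₀ : ℝ → ℝ≥0) (dens : Θ → ℝ → ℝ≥0) {n : ℕ} (x : Fin n → ℝ)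
    (θ : Θ) : ℝ≥0 :=
  ∏ i, dens θ (x i) / p₀ (x i)

/-- The posterior probability of `A` for the prior `prior` given the observations
`x_1, …, x_n`, by the Bayes formula. -/
def posterior {Θ : Type*} [MeasurableSpace Θ] (prior : Measure Θ) (p₀ : ℝ → ℝ≥0)
    (dens : Θ → ℝ → ℝ≥0) {n : ℕ} (x : Fin n → ℝ) (A : Set Θ) : ℝ :=
  ((∫⁻ θ in A, (likelihoodRatio p₀ dens x θ : ℝ≥0∞) ∂prior) /
    (∫⁻ θ, (likelihoodRatio p₀ dens x θ : ℝ≥0∞) ∂prior)).toReal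

end WassersteinPosterior

end

/-! On the line, the quantile coupling bounds `W_p^p` by `4^p` times the weighted distance `∫
|x|^(p-1) |F_P - F_0| dx` of distribution functions (`wasserstein_rpow_le`). It is therefore enough
that the posterior leaves the set where this distance is at least a constant times `ε`. In the same
distance the empirical distribution function `F_n` is within `O(n^(-1/2))` of `F_0` in mean, since a
moment of order `2p + δ` makes `|x|^(p-1) √(F_0 (1 - F_0))` integrable. As `n ε² ≥ log n → ∞`, the
event `E` that `F_n` is `ε`-close to `F_0` has probability tending to one. It does not depend on the
alternative, so it tests against all separated `P` at once, with no covering or entropy argument.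

The core is `lintegral_likelihoodRatio_le`: for each separated `P` with bounded moment, the
`P₀`-expectation of the likelihood ratio over `E` is at most `exp(-4nε²)`. The weighted distance is
attained by a signed weight `g`; the primitive `h` of `g`, truncated to `[-R, R]`, turns differences
of distribution functions into differences of means of `h`. On `E` the mean of `h` under `P` exceeds
its empirical mean by a multiple of `ε`. With `R^p = 1/ε` one has `|εh/2| ≤ 1`, while truncation
costs only `O(ε)`; and `|h(y)| ≤ 2|y|^p` bounds the second moment of `εh/2` by `ε²(1 + K)`. A
Chernoff bound under `P`, transferred by the likelihood ratio, gives the exponent.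

Integration over the prior bounds the numerator of the posterior. The denominator is at least
`exp(-3nε²)/2` with high probability, by Chebyshev's inequality on the Kullback–Leibler
neighbourhood and the prior mass condition. The parameters with large moment are removed by the
assumption on the posterior. -/

namespace WassersteinPosterior

/-! ### Wasserstein distance on the line through quantile functions -/

/-- The `L¹`-distance between two functions on the line, with weight `|x| ^ (p - 1)`. -/
noncomputable def weightedDist (p : ℝ) (F G : ℝ → ℝ) : ℝ≥0∞ :=
  ∫⁻ x, ENNReal.ofReal (|x| ^ (p - 1) * |F x - G x|)

/-- An interval of length `4d` has its first or its last quarter at distance at least `d` from the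
origin, according to the sign of its midpoint. That quarter alone contributes `d^(p-1) * d`. -/
lemma rpow_sub_le_lintegral {p : ℝ} (hp : 1 ≤ p) {a b : ℝ} (hab : a ≤ b) :
    ENNReal.ofReal ((b - a) ^ p) ≤
      ENNReal.ofReal (4 ^ p) * ∫⁻ x in Set.Ico a b, ENNReal.ofReal (|x| ^ (p - 1)) := by
  obtain ⟨d, hd0, rfl⟩ : ∃ d, 0 ≤ d ∧ b = a + 4 * d := ⟨(b - a) / 4, by linarith, by ring⟩
  obtain ⟨c, hac, hcb, hc⟩ : ∃ c, a ≤ c ∧ c + d ≤ a + 4 * d ∧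
      ∀ x ∈ Set.Ico c (c + d), d ≤ |x| := by
    rcases le_total 0 (a + 2 * d) with h | h
    · exact ⟨a + 3 * d, by linarith, by linarith,
        fun x hx => le_trans (by linarith [hx.1]) (le_abs_self x)⟩
    · exact ⟨a, le_rfl, by linarith, fun x hx => le_trans (by linarith [hx.2]) (neg_le_abs x)⟩
  have h1 : (a + 4 * d - a) ^ p = 4 ^ p * (d ^ (p - 1) * d) := by
    rcases hd0.eq_or_lt with rfl | hd
    · simp [Real.zero_rpow (by linarith : p ≠ 0)]
    · rw [add_sub_cancel_left, Real.mul_rpow (by norm_num) hd0, Real.rpow_sub_one hd.ne']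
      field_simp
  rw [h1, ENNReal.ofReal_mul (by positivity)]
  gcongr
  calc ENNReal.ofReal (d ^ (p - 1) * d)
      = ∫⁻ x in Set.Ico c (c + d), ENNReal.ofReal (d ^ (p - 1)) := by
        rw [setLIntegral_const, Real.volume_Ico, add_sub_cancel_left,
          ENNReal.ofReal_mul (by positivity)]
    _ ≤ ∫⁻ x in Set.Ico c (c + d), ENNReal.ofReal (|x| ^ (p - 1)) := by
        refine setLIntegral_mono' measurableSet_Ico fun x hx => ENNReal.ofReal_le_ofReal ?_
        exact Real.rpow_le_rpow hd0 (hc x hx) (by linarith)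
    _ ≤ _ := lintegral_mono_set (Set.Ico_subset_Ico hac hcb)

/-- The quantile function of a measure on the line (and `0` outside `(0, 1)`). -/
noncomputable def quantile (P : Measure ℝ) (u : ℝ) : ℝ :=
  open Classical in if u ∈ Set.Ioo 0 1 then sInf {x | u ≤ cdf P x} else 0

/-- Right continuity of the distribution function makes the infimum attained; `0 < u < 1` makes the
level set nonempty and bounded below. Measurability, the law of the quantile function and the
overlap estimate all follow from this equivalence. -/
lemma quantile_le_iff (P : Measure ℝ) {u : ℝ} (hu : u ∈ Set.Ioo 0 1) (x : ℝ) :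
    quantile P u ≤ x ↔ u ≤ cdf P x := by
  have hne : {x | u ≤ cdf P x}.Nonempty :=
    ((tendsto_cdf_atTop P).eventually (eventually_ge_nhds hu.2)).exists
  obtain ⟨b, hb⟩ := ((tendsto_cdf_atBot P).eventually (eventually_lt_nhds hu.1)).exists
  have hbdd : BddBelow {x | u ≤ cdf P x} :=
    ⟨b, fun x hx => le_of_lt ((monotone_cdf P).reflect_lt (hb.trans_le hx))⟩
  rw [quantile, if_pos hu]
  refine ⟨fun h => ?_, fun h => csInf_le hbdd h⟩
  refine ge_of_tendsto (((cdf P).right_continuous x).tendsto.mono_left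
    (nhdsWithin_mono x Set.Ioi_subset_Ici_self)) ?_
  filter_upwards [self_mem_nhdsWithin] with y hy
  obtain ⟨z, hz, hzy⟩ := (csInf_lt_iff hbdd hne).1 (h.trans_lt hy)
  exact le_trans hz (monotone_cdf P hzy.le)

lemma measurable_quantile (P : Measure ℝ) : Measurable (quantile P) := by
  refine measurable_of_Iic fun x => ?_
  have : quantile P ⁻¹' Set.Iic x =
      (Set.Ioo 0 1 ∩ Set.Iic (cdf P x)) ∪ ((Set.Ioo 0 1)ᶜ ∩ {_u | (0 : ℝ) ≤ x}) := by
    ext u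
    by_cases hu : u ∈ Set.Ioo (0 : ℝ) 1
    · simp only [Set.mem_preimage, Set.mem_Iic, quantile_le_iff P hu]
      simp [hu, -Set.mem_Ioo]
    · simp [hu, quantile, -Set.mem_Ioo]
  rw [this]
  exact (measurableSet_Ioo.inter measurableSet_Iic).union
    (measurableSet_Ioo.compl.inter (MeasurableSet.const _))

lemma map_quantile (P : Measure ℝ) [IsProbabilityMeasure P] :
    (volume.restrict (Set.Ioo (0 : ℝ) 1)).map (quantile P) = P := by
  refine Measure.ext_of_Iic _ _ fun x => ?_
  rw [Measure.map_apply (measurable_quantile P) measurableSet_Iic,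
    Measure.restrict_apply (measurable_quantile P measurableSet_Iic), ← ofReal_cdf]
  have h : quantile P ⁻¹' Set.Iic x ∩ Set.Ioo 0 1 = Set.Ioc 0 (cdf P x) ∩ Set.Iio 1 := by
    ext u
    constructor
    · rintro ⟨h1, h2⟩
      exact ⟨⟨h2.1, (quantile_le_iff P h2 x).1 h1⟩, h2.2⟩
    · rintro ⟨h1, h2⟩
      exact ⟨(quantile_le_iff P ⟨h1.1, h2⟩ x).2 h1.2, h1.1, h2⟩
  rw [h]
  apply le_antisymm
  · exact (measure_mono Set.inter_subset_left).trans (by simp)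
  · calc ENNReal.ofReal (cdf P x) = volume (Set.Ioo 0 (cdf P x)) := by simp
      _ ≤ volume (Set.Ioc 0 (cdf P x) ∩ Set.Iio 1) := measure_mono fun u hu =>
        ⟨⟨hu.1, hu.2.le⟩, hu.2.trans_le (cdf_le_one P x)⟩

lemma volume_quantile_le_lt (P Q : Measure ℝ) (x : ℝ) :
    volume.restrict (Set.Ioo (0 : ℝ) 1) {u | quantile P u ≤ x ∧ x < quantile Q u} ≤
      ENNReal.ofReal (cdf P x - cdf Q x) := by
  have hS : MeasurableSet {u | quantile P u ≤ x ∧ x < quantile Q u} :=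
    (measurable_quantile P measurableSet_Iic).inter (measurable_quantile Q measurableSet_Ioi)
  rw [Measure.restrict_apply hS, ← Real.volume_Ioc]
  refine measure_mono ?_
  rintro u ⟨⟨h1, h2⟩, hu⟩
  exact Set.mem_Ioc.2 ⟨by simpa [quantile_le_iff Q hu] using h2.not_ge,
    (quantile_le_iff P hu x).1 h1⟩

/-- Tonelli: for fixed `x`, the levels `u` whose quantile interval contains `x` lie in `(F_P(x),
F_Q(x)]` with the roles of `P` and `Q` exchanged, that is in `(F_Q(x), F_P(x)]`. -/
lemma lintegral_quantile_le (p : ℝ) (P Q : Measure ℝ) :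
    ∫⁻ u in Set.Ioo (0 : ℝ) 1, ∫⁻ x in Set.Ico (quantile P u) (quantile Q u),
        ENNReal.ofReal (|x| ^ (p - 1)) ≤
      ∫⁻ x, ENNReal.ofReal (|x| ^ (p - 1)) * ENNReal.ofReal (cdf P x - cdf Q x) := by
  have hS : MeasurableSet {z : ℝ × ℝ | quantile P z.1 ≤ z.2 ∧ z.2 < quantile Q z.1} :=
    (measurableSet_le ((measurable_quantile P).comp measurable_fst) measurable_snd).inter
      (measurableSet_lt measurable_snd ((measurable_quantile Q).comp measurable_fst))
  have hw : Measurable fun x : ℝ => ENNReal.ofReal (|x| ^ (p - 1)) := by fun_prop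
  calc _ = ∫⁻ u in Set.Ioo (0 : ℝ) 1, ∫⁻ x, ENNReal.ofReal (|x| ^ (p - 1)) *
        {z : ℝ × ℝ | quantile P z.1 ≤ z.2 ∧ z.2 < quantile Q z.1}.indicator 1 (u, x) := by
        refine lintegral_congr fun u => ?_
        rw [← lintegral_indicator measurableSet_Ico]
        refine lintegral_congr fun x => ?_
        simp [Set.indicator_apply]
    _ = ∫⁻ x, ∫⁻ u in Set.Ioo (0 : ℝ) 1, ENNReal.ofReal (|x| ^ (p - 1)) *
        {z : ℝ × ℝ | quantile P z.1 ≤ z.2 ∧ z.2 < quantile Q z.1}.indicator 1 (u, x) := by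
        refine lintegral_lintegral_swap (Measurable.aemeasurable ?_)
        exact (hw.comp measurable_snd).mul (measurable_one.indicator hS)
    _ ≤ _ := by
        refine lintegral_mono fun x => ?_
        rw [lintegral_const_mul' _ _ ENNReal.ofReal_ne_top]
        gcongr
        refine le_trans (le_of_eq ?_) (volume_quantile_le_lt P Q x)
        exact lintegral_indicator_one (measurable_prodMk_right (y := x) hS)

/-- The Wasserstein distance on the line is bounded by a weighted `L¹`-distance between the
distribution functions. -/
lemma wasserstein_rpow_le {p : ℝ} (hp : 1 ≤ p) (P Q : Measure ℝ) [IsProbabilityMeasure P]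
    [IsProbabilityMeasure Q] :
    wasserstein p P Q ^ p ≤ ENNReal.ofReal (4 ^ p) * weightedDist p (cdf P) (cdf Q) := by
  have hm := (measurable_quantile P).prodMk (measurable_quantile Q)
  set γ := (volume.restrict (Set.Ioo (0 : ℝ) 1)).map fun u => (quantile P u, quantile Q u)
    with hγ
  have hmem : γ ∈ couplings P Q := by
    constructor
    · rw [hγ, Measure.map_map measurable_fst hm]
      exact map_quantile P
    · rw [hγ, Measure.map_map measurable_snd hm]
      exact map_quantile Q
  have hw : Measurable fun x : ℝ => ENNReal.ofReal (|x| ^ (p - 1)) := by fun_prop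
  calc wasserstein p P Q ^ p
      ≤ ((∫⁻ z, ENNReal.ofReal (|z.1 - z.2| ^ p) ∂γ) ^ (1 / p)) ^ p := by
        gcongr
        exact iInf₂_le γ hmem
    _ = ∫⁻ u in Set.Ioo (0 : ℝ) 1, ENNReal.ofReal (|quantile P u - quantile Q u| ^ p) := by
        rw [← ENNReal.rpow_mul, one_div_mul_cancel (by linarith), ENNReal.rpow_one, hγ,
          lintegral_map (by fun_prop) hm]
    _ ≤ ∫⁻ u in Set.Ioo (0 : ℝ) 1, ENNReal.ofReal (4 ^ p) *
          ((∫⁻ x in Set.Ico (quantile P u) (quantile Q u), ENNReal.ofReal (|x| ^ (p - 1))) +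
          ∫⁻ x in Set.Ico (quantile Q u) (quantile P u), ENNReal.ofReal (|x| ^ (p - 1))) := by
        refine lintegral_mono fun u => ?_
        -- At least one of the two half-open intervals is empty, so their sum covers both orders of
        -- the quantiles.
        rcases le_total (quantile P u) (quantile Q u) with h | h
        · rw [abs_sub_comm, abs_of_nonneg (sub_nonneg.2 h)]
          exact (rpow_sub_le_lintegral hp h).trans (by gcongr; exact le_self_add)
        · rw [abs_of_nonneg (sub_nonneg.2 h)]
          exact (rpow_sub_le_lintegral hp h).trans (by gcongr; exact le_add_self)
    _ ≤ ENNReal.ofReal (4 ^ p) *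
          ((∫⁻ x, ENNReal.ofReal (|x| ^ (p - 1)) * ENNReal.ofReal (cdf P x - cdf Q x)) +
          ∫⁻ x, ENNReal.ofReal (|x| ^ (p - 1)) * ENNReal.ofReal (cdf Q x - cdf P x)) := by
        rw [lintegral_const_mul' _ _ ENNReal.ofReal_ne_top]
        gcongr
        have hmeas : ∀ P Q : Measure ℝ, Measurable fun u : ℝ =>
            ∫⁻ x in Set.Ico (quantile P u) (quantile Q u), ENNReal.ofReal (|x| ^ (p - 1)) := by
          intro P Q
          have hS : MeasurableSet {z : ℝ × ℝ | quantile P z.1 ≤ z.2 ∧ z.2 < quantile Q z.1} :=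
            (measurableSet_le ((measurable_quantile P).comp measurable_fst) measurable_snd).inter
              (measurableSet_lt measurable_snd ((measurable_quantile Q).comp measurable_fst))
          have := ((hw.comp measurable_snd).indicator hS).lintegral_prod_right' (ν := volume)
          convert this using 2 with u
          rw [← lintegral_indicator measurableSet_Ico]
          rfl
        rw [lintegral_add_left (hmeas P Q)]
        exact add_le_add (lintegral_quantile_le p P Q) (lintegral_quantile_le p Q P)
    _ = _ := by
        have hc : ∀ P Q : Measure ℝ, Measurable fun x : ℝ => cdf P x - cdf Q x := fun P Q =>
          (monotone_cdf P).measurable.sub (monotone_cdf Q).measurable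
        rw [← lintegral_add_left (by exact hw.mul (hc P Q).ennreal_ofReal), weightedDist]
        congr 1
        refine lintegral_congr fun x => ?_
        rw [← mul_add, ENNReal.ofReal_mul (by positivity)]
        congr 1
        rcases le_total (cdf P x) (cdf Q x) with h | h
        · rw [ENNReal.ofReal_of_nonpos (sub_nonpos.2 h), zero_add, abs_sub_comm,
            abs_of_nonneg (sub_nonneg.2 h)]
        · rw [ENNReal.ofReal_of_nonpos (sub_nonpos.2 h), add_zero,
            abs_of_nonneg (sub_nonneg.2 h)]

/-! ### Tails of distribution functions under a moment bound -/

/-- Markov's inequality for `t ≥ 1` and the trivial bound `1` for `t ≤ 1`; replacing `t` by `1 + t`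
costs the factor `2^q`. -/
lemma measureReal_le_abs_le {P : Measure ℝ} [IsProbabilityMeasure P] {q K : ℝ} (hq : 0 < q)
    (hK : 0 ≤ K) (hP : absMoment q P ≤ ENNReal.ofReal K) {t : ℝ} (ht : 0 ≤ t) :
    P.real {x | t ≤ |x|} ≤ 2 ^ q * (1 + K) * (1 + t) ^ (-q) := by
  rcases le_total t 1 with h1 | h1
  · have h2 : (2 : ℝ) ^ (-q) ≤ (1 + t) ^ (-q) :=
      Real.rpow_le_rpow_of_nonpos (by linarith) (by linarith) (by linarith)
    calc P.real {x | t ≤ |x|} ≤ 1 := measureReal_le_one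
      _ ≤ 1 + K := by linarith
      _ = 2 ^ q * (1 + K) * 2 ^ (-q) := by
        rw [Real.rpow_neg (by norm_num)]; field_simp
      _ ≤ _ := by gcongr
  · have h0 : 0 < t := by linarith
    have h2 : ENNReal.ofReal (t ^ q) * P {x | t ≤ |x|} ≤ ENNReal.ofReal K := by
      refine le_trans ?_ hP
      refine le_trans ?_ (mul_meas_ge_le_lintegral (μ := P)
        (f := fun x => ENNReal.ofReal (|x| ^ q)) (by fun_prop) (ENNReal.ofReal (t ^ q)))
      gcongr with x
      intro hx
      exact ENNReal.ofReal_le_ofReal (Real.rpow_le_rpow ht hx hq.le)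
    have h3 : t ^ q * P.real {x | t ≤ |x|} ≤ K := by
      rw [← ENNReal.ofReal_le_ofReal_iff hK, ENNReal.ofReal_mul (by positivity),
        ofReal_measureReal]
      exact h2
    have h4 : (1 + t) ^ q ≤ 2 ^ q * t ^ q := by
      rw [← Real.mul_rpow (by norm_num) ht]
      exact Real.rpow_le_rpow (by linarith) (by linarith) hq.le
    rw [Real.rpow_neg (by linarith), ← div_eq_mul_inv, le_div_iff₀ (by positivity)]
    calc P.real {x | t ≤ |x|} * (1 + t) ^ q
        ≤ P.real {x | t ≤ |x|} * (2 ^ q * t ^ q) := by gcongr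
      _ = 2 ^ q * (t ^ q * P.real {x | t ≤ |x|}) := by ring
      _ ≤ 2 ^ q * K := by gcongr
      _ ≤ _ := by gcongr; linarith

lemma cdf_le_of_neg {P : Measure ℝ} [IsProbabilityMeasure P] {q K : ℝ} (hq : 0 < q)
    (hK : 0 ≤ K) (hP : absMoment q P ≤ ENNReal.ofReal K) {x : ℝ} (hx : x < 0) :
    cdf P x ≤ 2 ^ q * (1 + K) * (1 + |x|) ^ (-q) := by
  rw [cdf_eq_real]
  refine le_trans (measureReal_mono fun y hy => ?_)
    (measureReal_le_abs_le hq hK hP (abs_nonneg x))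
  simp only [Set.mem_Iic, Set.mem_ofPred_eq] at *
  rw [abs_of_neg hx, abs_of_neg (by linarith)]
  linarith

lemma one_sub_cdf_le_of_nonneg {P : Measure ℝ} [IsProbabilityMeasure P] {q K : ℝ} (hq : 0 < q)
    (hK : 0 ≤ K) (hP : absMoment q P ≤ ENNReal.ofReal K) {x : ℝ} (hx : 0 ≤ x) :
    1 - cdf P x ≤ 2 ^ q * (1 + K) * (1 + |x|) ^ (-q) := by
  rw [cdf_eq_real, ← probReal_compl_eq_one_sub measurableSet_Iic]
  refine le_trans (measureReal_mono fun y hy => ?_)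
    (measureReal_le_abs_le hq hK hP (abs_nonneg x))
  simp only [Set.mem_compl_iff, Set.mem_Iic, Set.mem_ofPred_eq, not_le] at *
  rw [abs_of_nonneg hx]
  exact hy.le.trans (le_abs_self y)

lemma cdf_mul_one_sub_cdf_le {P : Measure ℝ} [IsProbabilityMeasure P] {q K : ℝ} (hq : 0 < q)
    (hK : 0 ≤ K) (hP : absMoment q P ≤ ENNReal.ofReal K) (x : ℝ) :
    cdf P x * (1 - cdf P x) ≤ 2 ^ q * (1 + K) * (1 + |x|) ^ (-q) := by
  have h0 := cdf_nonneg P x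
  have h1 := cdf_le_one P x
  rcases lt_or_ge x 0 with hx | hx
  · exact le_trans (by nlinarith) (cdf_le_of_neg hq hK hP hx)
  · exact le_trans (by nlinarith) (one_sub_cdf_le_of_nonneg hq hK hP hx)

lemma abs_cdf_sub_cdf_le {P Q : Measure ℝ} [IsProbabilityMeasure P] [IsProbabilityMeasure Q]
    {q K : ℝ} (hq : 0 < q) (hK : 0 ≤ K) (hP : absMoment q P ≤ ENNReal.ofReal K)
    (hQ : absMoment q Q ≤ ENNReal.ofReal K) (x : ℝ) :
    |cdf P x - cdf Q x| ≤ 2 ^ q * (1 + K) * (1 + |x|) ^ (-q) := by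
  have hP0 := cdf_nonneg P x
  have hP1 := cdf_le_one P x
  have hQ0 := cdf_nonneg Q x
  have hQ1 := cdf_le_one Q x
  rw [abs_le]
  rcases lt_or_ge x 0 with hx | hx
  · have := cdf_le_of_neg hq hK hP hx
    have := cdf_le_of_neg hq hK hQ hx
    constructor <;> linarith
  · have := one_sub_cdf_le_of_nonneg hq hK hP hx
    have := one_sub_cdf_le_of_nonneg hq hK hQ hx
    constructor <;> linarith

lemma lintegral_one_add_abs_rpow_lt_top {r : ℝ} (hr : 1 < r) :
    ∫⁻ x : ℝ, ENNReal.ofReal ((1 + |x|) ^ (-r)) < ∞ := by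
  have := (integrable_one_add_norm (E := ℝ) (μ := volume) (r := r) (by simpa using hr))
  exact this.lintegral_lt_top

/-! ### The empirical distribution function in weighted `L¹` -/

section Sample

variable {Ω : Type*} [MeasurableSpace Ω] {μ : Measure Ω} {P : Measure ℝ} {n : ℕ} {X : Fin n → Ω → ℝ}

lemma variance_sum_comp (hX : ∀ i, Measurable (X i)) (hindep : iIndepFun X μ)
    (hlaw : ∀ i, μ.map (X i) = P) {f : ℝ → ℝ} (hf : Measurable f) (hf2 : MemLp f 2 P) :
    variance (fun ω => ∑ i, f (X i ω)) μ = n * variance f P := by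
  have hmem : ∀ i, MemLp (fun ω => f (X i ω)) 2 μ := fun i => by
    rw [← hlaw i] at hf2
    exact hf2.comp_of_map (hX i).aemeasurable
  have := IndepFun.variance_sum (μ := μ) (s := Finset.univ) (X := fun i ω => f (X i ω))
    (fun i _ => hmem i) (fun i _ j _ hij => (hindep.indepFun hij).comp hf hf)
  rw [show (fun ω => ∑ i, f (X i ω)) = ∑ i, fun ω => f (X i ω) by ext; simp, this]
  rw [Finset.sum_congr rfl (g := fun _ => variance f P)]
  · simp
  · intro i _
    rw [← hlaw i, variance_map (by exact hf.aemeasurable) (hX i).aemeasurable]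
    rfl

lemma integral_sum_comp (hX : ∀ i, Measurable (X i))
    (hlaw : ∀ i, μ.map (X i) = P) {f : ℝ → ℝ} (hf : Integrable f P) :
    ∫ ω, ∑ i, f (X i ω) ∂μ = n * ∫ x, f x ∂P := by
  have hint : ∀ i, Integrable (fun ω => f (X i ω)) μ := fun i => by
    rw [← hlaw i] at hf
    exact hf.comp_measurable (hX i)
  rw [integral_finsetSum _ fun i _ => hint i, Finset.sum_congr rfl (g := fun _ => ∫ x, f x ∂P)]
  · simp
  · intro i _
    have hf' := hf
    rw [← hlaw i] at hf' ⊢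
    exact (integral_map (hX i).aemeasurable hf'.aestronglyMeasurable).symm

/-- The empirical distribution function of the sample `x`. -/
noncomputable def empiricalCDF (x : Fin n → ℝ) (t : ℝ) : ℝ :=
  (∑ i, (Set.Iic t).indicator 1 (x i)) / n

lemma measurable_empiricalCDF (hX : ∀ i, Measurable (X i)) :
    Measurable fun z : Ω × ℝ => empiricalCDF (fun i => X i z.1) z.2 := by
  refine (Finset.measurable_sum _ fun i _ => ?_).div_const _
  have hS : MeasurableSet {z : Ω × ℝ | X i z.1 ≤ z.2} :=
    measurableSet_le ((hX i).comp measurable_fst) measurable_snd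
  exact (measurable_one.indicator hS : Measurable ({z : Ω × ℝ | X i z.1 ≤ z.2}.indicator
    (1 : Ω × ℝ → ℝ)))

lemma lintegral_abs_le_sqrt [IsProbabilityMeasure μ] {Z : Ω → ℝ} (hZ : MemLp Z 2 μ) :
    ∫⁻ ω, ENNReal.ofReal |Z ω| ∂μ ≤ ENNReal.ofReal √(∫ ω, Z ω ^ 2 ∂μ) := by
  rw [← ofReal_integral_eq_lintegral_ofReal (hZ.integrable (by norm_num)).abs
    (Eventually.of_forall fun _ => abs_nonneg _)]
  refine ENNReal.ofReal_le_ofReal (Real.le_sqrt_of_sq_le ?_)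
  have h := variance_nonneg (fun ω => |Z ω|) μ
  rw [variance_eq_sub (X := fun ω => |Z ω|) hZ.abs] at h
  simpa using h

/-- The first absolute moment is at most the standard deviation, and an indicator with mean `F(t)`
has variance `F(t)(1 - F(t))`. -/
lemma lintegral_abs_empiricalCDF_sub_le [IsProbabilityMeasure μ]
    [IsProbabilityMeasure P] (hn : 0 < n)
    (hX : ∀ i, Measurable (X i)) (hindep : iIndepFun X μ) (hlaw : ∀ i, μ.map (X i) = P) (t : ℝ) :
    ∫⁻ ω, ENNReal.ofReal |empiricalCDF (fun i => X i ω) t - cdf P t| ∂μ ≤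
      ENNReal.ofReal √(cdf P t * (1 - cdf P t) / n) := by
  have hn' : (0 : ℝ) < n := by exact_mod_cast hn
  set f : ℝ → ℝ := (Set.Iic t).indicator 1 with hf
  have hfm : Measurable f := measurable_one.indicator measurableSet_Iic
  have hf2 : MemLp f 2 P := (memLp_const (1 : ℝ)).indicator measurableSet_Iic
  have hint : ∫ x, f x ∂P = cdf P t := by
    rw [hf, integral_indicator_one measurableSet_Iic, cdf_eq_real]
  have hvar : variance f P = cdf P t * (1 - cdf P t) := by
    rw [variance_eq_sub hf2, hint]
    have : f ^ 2 = f := by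
      ext x; simp only [hf, Pi.pow_apply, Set.indicator_apply]; split_ifs <;> simp
    rw [this, hint]; ring
  have hS : MemLp (fun ω => ∑ i, f (X i ω)) 2 μ := memLp_finsetSum _ fun i _ => by
    rw [← hlaw i] at hf2
    exact hf2.comp_of_map (hX i).aemeasurable
  have hZ : ∀ ω, empiricalCDF (fun i => X i ω) t - cdf P t =
      (n : ℝ)⁻¹ * (∑ i, f (X i ω) - n * cdf P t) := fun ω => by
    rw [empiricalCDF]; field_simp; rfl
  refine (lintegral_abs_le_sqrt ?_).trans_eq ?_
  · simp only [hZ]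
    exact (hS.sub (memLp_const _)).const_mul _
  · congr 2
    have h1 := variance_sum_comp hX hindep hlaw hfm hf2
    rw [variance_eq_integral hS.aestronglyMeasurable.aemeasurable,
      integral_sum_comp hX hlaw (hf2.integrable (by norm_num)), hint, hvar] at h1
    simp only [hZ, mul_pow]
    rw [integral_const_mul, h1]
    field_simp

lemma measurable_weightedDist_empiricalCDF (p : ℝ) (hX : ∀ i, Measurable (X i)) {F : ℝ → ℝ}
    (hF : Measurable F) :
    Measurable fun ω => weightedDist p (empiricalCDF fun i => X i ω) F := by
  have hm := measurable_empiricalCDF hX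
  have : Measurable fun z : Ω × ℝ => ENNReal.ofReal (|z.2| ^ (p - 1) *
      |empiricalCDF (fun i => X i z.1) z.2 - F z.2|) := by fun_prop
  exact this.lintegral_prod_right'

/-- The expected weighted `L¹`-distance between the empirical and the true distribution function
is of order `n ^ (-1 / 2)`. -/
lemma lintegral_weightedDist_empiricalCDF_le [IsProbabilityMeasure μ]
    [IsProbabilityMeasure P] (hn : 0 < n)
    (hX : ∀ i, Measurable (X i)) (hindep : iIndepFun X μ) (hlaw : ∀ i, μ.map (X i) = P) {p δ K : ℝ} (hp : 1 < p) (hδ : 0 < δ)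
    (hK : 0 ≤ K) (hP : absMoment (2 * p + δ) P ≤ ENNReal.ofReal K) :
    ∫⁻ ω, weightedDist p (empiricalCDF fun i => X i ω) (cdf P) ∂μ ≤
      ENNReal.ofReal √(2 ^ (2 * p + δ) * (1 + K) / n) *
        ∫⁻ x : ℝ, ENNReal.ofReal ((1 + |x|) ^ (-(1 + δ / 2))) := by
  have hm := measurable_empiricalCDF hX
  have hF : Measurable (cdf P) := (monotone_cdf P).measurable
  have hm2 : Measurable fun z : Ω × ℝ => ENNReal.ofReal (|z.2| ^ (p - 1) *
      |empiricalCDF (fun i => X i z.1) z.2 - cdf P z.2|) := by fun_prop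
  simp only [weightedDist]
  rw [lintegral_lintegral_swap hm2.aemeasurable, ← lintegral_const_mul _ (by fun_prop)]
  refine lintegral_mono fun x => ?_
  simp only [ENNReal.ofReal_mul (Real.rpow_nonneg (abs_nonneg x) (p - 1))]
  rw [lintegral_const_mul' _ _ ENNReal.ofReal_ne_top]
  grw [lintegral_abs_empiricalCDF_sub_le hn hX hindep hlaw x,
    cdf_mul_one_sub_cdf_le (by linarith) hK hP x]
  rw [← ENNReal.ofReal_mul (by positivity), ← ENNReal.ofReal_mul (by positivity)]
  refine ENNReal.ofReal_le_ofReal ?_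
  -- The square root halves the decay exponent `2p + δ`; after multiplication by the weight of order
  -- `p - 1`, the exponent `-(1 + δ/2)` remains, which is just integrable.
  have h1 : √(2 ^ (2 * p + δ) * (1 + K) * (1 + |x|) ^ (-(2 * p + δ)) / n) =
      √(2 ^ (2 * p + δ) * (1 + K) / n) * (1 + |x|) ^ (-(p + δ / 2)) := by
    rw [mul_div_right_comm, Real.sqrt_mul (by positivity), Real.sqrt_eq_rpow ((1 + |x|) ^ _),
      ← Real.rpow_mul (by positivity)]
    congr 2; ring
  have h2 : (1 + |x|) ^ (-(1 + δ / 2)) = (1 + |x|) ^ (p - 1) * (1 + |x|) ^ (-(p + δ / 2)) := by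
    rw [← Real.rpow_add (by positivity)]; congr 1; ring
  have h3 : |x| ^ (p - 1) ≤ (1 + |x|) ^ (p - 1) :=
    Real.rpow_le_rpow (abs_nonneg x) (by linarith) (by linarith)
  rw [h1, h2, mul_left_comm]
  gcongr

end Sample

/-! ### Test functions dual to the weighted distance -/

/-- The difference `1{y ≤ x} - 1{0 ≤ x}`. -/
noncomputable def stepKernel (x y : ℝ) : ℝ :=
  (Set.Iic x).indicator 1 y - (Set.Iic x).indicator 1 0

lemma measurable_stepKernel : Measurable fun z : ℝ × ℝ => stepKernel z.1 z.2 := by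
  have h1 : MeasurableSet {z : ℝ × ℝ | z.2 ≤ z.1} := measurableSet_le measurable_snd measurable_fst
  have h2 : MeasurableSet {z : ℝ × ℝ | 0 ≤ z.1} :=
    measurableSet_le measurable_const measurable_fst
  exact (measurable_one.indicator h1 : Measurable ({z : ℝ × ℝ | z.2 ≤ z.1}.indicator
    (1 : ℝ × ℝ → ℝ))).sub (measurable_one.indicator h2 : Measurable
    ({z : ℝ × ℝ | 0 ≤ z.1}.indicator (1 : ℝ × ℝ → ℝ)))

/-- Subtracting `1{0 ≤ x}` leaves a kernel that lives only between `0` and `y`; this is what limits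
the growth of the test function to `|y|^p`. -/
lemma abs_stepKernel_le (x y : ℝ) :
    |stepKernel x y| ≤ (Set.Icc (-|y|) |y|).indicator 1 x := by
  simp only [stepKernel, Set.indicator_apply, Set.mem_Iic, Set.mem_Icc, Pi.one_apply]
  have h1 := neg_abs_le y
  have h2 := le_abs_self y
  split_ifs with ha hb hc hc hb hc hc <;> norm_num
  · exact hc ⟨by linarith [abs_nonneg y], by linarith⟩
  · exact hc ⟨by linarith, by linarith⟩

lemma abs_stepKernel_le_one (x y : ℝ) : |stepKernel x y| ≤ 1 :=
  (abs_stepKernel_le x y).trans (Set.indicator_le_self' (by simp) x)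

/-- The primitive of `g` truncated to `[-R, R]`, normalised at `0`, up to sign. -/
noncomputable def testFun (g : ℝ → ℝ) (R y : ℝ) : ℝ :=
  ∫ x in Set.Icc (-R) R, g x * stepKernel x y

section TestFun

variable {g : ℝ → ℝ} {p R : ℝ}

lemma measurable_testFun (hg : Measurable g) : Measurable (testFun g R) := by
  have hm := measurable_stepKernel
  have : Measurable fun z : ℝ × ℝ => g z.1 * stepKernel z.1 z.2 := by fun_prop
  exact (this.stronglyMeasurable.integral_prod_left' (μ := volume.restrict _)).measurable

lemma abs_mul_stepKernel_le (hp : 1 ≤ p) (hgp : ∀ x, |g x| ≤ |x| ^ (p - 1)) {x : ℝ}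
    (hx : x ∈ Set.Icc (-R) R) (y : ℝ) : ‖g x * stepKernel x y‖ ≤ R ^ (p - 1) := by
  rw [Real.norm_eq_abs, abs_mul]
  calc |g x| * |stepKernel x y| ≤ |x| ^ (p - 1) * 1 := by
        gcongr
        exacts [hgp x, abs_stepKernel_le_one x y]
    _ ≤ R ^ (p - 1) := by
        rw [mul_one]
        exact Real.rpow_le_rpow (abs_nonneg x) (abs_le.2 hx) (by linarith)

/-- The bound uniform in `y`: it keeps the exponent of the Chernoff bound in `[-1, 1]`. -/
lemma abs_testFun_le (hp : 1 < p) (hR : 0 ≤ R) (hgp : ∀ x, |g x| ≤ |x| ^ (p - 1)) (y : ℝ) :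
    |testFun g R y| ≤ 2 * R ^ p := by
  have h := norm_setIntegral_le_of_norm_le_const (μ := volume) (s := Set.Icc (-R) R)
    (f := fun x => g x * stepKernel x y) (C := R ^ (p - 1)) (by simp)
    fun x hx => abs_mul_stepKernel_le hp.le hgp hx y
  refine h.trans (le_of_eq ?_)
  rw [Real.volume_real_Icc_of_le (by linarith), sub_neg_eq_add]
  rcases hR.eq_or_lt with rfl | hR
  · simp [Real.zero_rpow (by linarith : p ≠ 0)]
  · rw [Real.rpow_sub_one hR.ne']; field_simp; ring

/-- The bound free of `R`: it controls the second moment of the test function by a moment of order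
`2p`, however large the truncation level. -/
lemma abs_testFun_le_abs_rpow (hp : 1 < p) (hgp : ∀ x, |g x| ≤ |x| ^ (p - 1)) (y : ℝ) :
    |testFun g R y| ≤ 2 * |y| ^ p := by
  have hint : Integrable ((Set.Icc (-|y|) |y|).indicator fun _ => |y| ^ (p - 1)) :=
    (integrable_indicator_iff measurableSet_Icc).2 (by simp)
  calc |testFun g R y|
      ≤ ∫ x in Set.Icc (-R) R, (Set.Icc (-|y|) |y|).indicator (fun _ => |y| ^ (p - 1)) x := by
        refine norm_integral_le_of_norm_le (f := fun x => g x * stepKernel x y)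
          hint.integrableOn (Eventually.of_forall fun x => ?_)
        rw [Real.norm_eq_abs, abs_mul]
        have h := abs_stepKernel_le x y
        by_cases hx : x ∈ Set.Icc (-|y|) |y|
        · rw [Set.indicator_of_mem hx]
          have := abs_mul_stepKernel_le hp.le hgp hx y
          rwa [Real.norm_eq_abs, abs_mul] at this
        · rw [Set.indicator_of_notMem hx] at h ⊢
          rw [le_antisymm h (abs_nonneg _), mul_zero]
    _ ≤ ∫ x, (Set.Icc (-|y|) |y|).indicator (fun _ => |y| ^ (p - 1)) x :=
        setIntegral_le_integral hint (Eventually.of_forall fun x =>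
          Set.indicator_nonneg (fun _ _ => by positivity) x)
    _ = 2 * |y| ^ p := by
        rw [integral_indicator measurableSet_Icc, setIntegral_const,
          Real.volume_real_Icc_of_le (by linarith [abs_nonneg y])]
        rcases (abs_nonneg y).eq_or_lt with h | h
        · simp [← h, Real.zero_rpow (by linarith : p ≠ 0)]
        · rw [Real.rpow_sub_one h.ne', smul_eq_mul]; field_simp; ring

lemma integrable_mul_of_bounded (hp : 1 ≤ p) (hg : Measurable g)
    (hgp : ∀ x, |g x| ≤ |x| ^ (p - 1)) {F : ℝ → ℝ} (hF : Measurable F) (hF1 : ∀ x, |F x| ≤ 1) :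
    IntegrableOn (fun x => g x * F x) (Set.Icc (-R) R) := by
  refine IntegrableOn.of_bound (by simp) (by fun_prop) (R ^ (p - 1))
    ((ae_restrict_iff' measurableSet_Icc).2 (Eventually.of_forall fun x hx => ?_))
  rw [Real.norm_eq_abs, abs_mul]
  calc |g x| * |F x| ≤ |x| ^ (p - 1) * 1 := by
        gcongr
        exacts [hgp x, hF1 x]
    _ ≤ R ^ (p - 1) := by
        rw [mul_one]
        exact Real.rpow_le_rpow (abs_nonneg x) (abs_le.2 hx) (by linarith)

lemma integral_testFun (hp : 1 ≤ p) (hg : Measurable g) (hgp : ∀ x, |g x| ≤ |x| ^ (p - 1))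
    (P : Measure ℝ) [IsProbabilityMeasure P] :
    ∫ y, testFun g R y ∂P =
      ∫ x in Set.Icc (-R) R, g x * (cdf P x - (Set.Iic x).indicator 1 0) := by
  have hm := measurable_stepKernel
  have hm2 : Measurable fun z : ℝ × ℝ => g z.2 * stepKernel z.2 z.1 := by fun_prop
  simp only [testFun]
  rw [integral_integral_swap]
  · refine setIntegral_congr_fun measurableSet_Icc fun x _ => ?_
    simp only [stepKernel]
    rw [integral_const_mul, integral_sub (by
      exact (integrable_const (1 : ℝ)).indicator measurableSet_Iic) (integrable_const _), integral_indicator_one measurableSet_Iic, cdf_eq_real]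
    simp
  · refine Integrable.of_bound hm2.aestronglyMeasurable (R ^ (p - 1)) ?_
    have : ∀ᵐ z ∂(P.prod (volume.restrict (Set.Icc (-R) R))), z.2 ∈ Set.Icc (-R) R :=
      Measure.quasiMeasurePreserving_snd.ae (ae_restrict_mem measurableSet_Icc)
    filter_upwards [this] with z hz
    exact abs_mul_stepKernel_le hp hgp hz z.1

lemma abs_stepFun_le_one (x y : ℝ) : |(Set.Iic x).indicator (1 : ℝ → ℝ) y| ≤ 1 := by
  rw [Set.indicator_apply]; split_ifs <;> simp

lemma measurable_indicator_Iic (y : ℝ) :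
    Measurable fun x : ℝ => (Set.Iic x).indicator (1 : ℝ → ℝ) y :=
  (measurable_one.indicator measurableSet_Ici : Measurable ((Set.Ici y).indicator (1 : ℝ → ℝ)))

lemma measurable_empiricalCDF_right {n : ℕ} (x : Fin n → ℝ) : Measurable (empiricalCDF x) :=
  (Finset.measurable_sum _ fun i _ => measurable_indicator_Iic (x i)).div_const _

lemma empiricalCDF_mem_Icc {n : ℕ} (x : Fin n → ℝ) (t : ℝ) :
    empiricalCDF x t ∈ Set.Icc 0 1 := by
  have h0 : ∀ i, 0 ≤ (Set.Iic t).indicator (1 : ℝ → ℝ) (x i) := fun i =>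
    Set.indicator_nonneg (by simp) _
  have h1 : ∀ i, (Set.Iic t).indicator (1 : ℝ → ℝ) (x i) ≤ 1 := fun i =>
    (le_abs_self _).trans (abs_stepFun_le_one _ _)
  refine ⟨div_nonneg (Finset.sum_nonneg fun i _ => h0 i) (by positivity), ?_⟩
  refine div_le_one_of_le₀ ((Finset.sum_le_sum fun i _ => h1 i).trans ?_) (by positivity)
  simp

lemma sum_testFun (hp : 1 ≤ p) (hg : Measurable g) (hgp : ∀ x, |g x| ≤ |x| ^ (p - 1)) {n : ℕ}
    (x : Fin n → ℝ) :
    ∑ i, testFun g R (x i) =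
      n * ∫ t in Set.Icc (-R) R, g t * (empiricalCDF x t - (Set.Iic t).indicator 1 0) := by
  have hm := measurable_stepKernel
  simp only [testFun]
  rw [← integral_finsetSum, ← integral_const_mul]
  · refine setIntegral_congr_fun measurableSet_Icc fun t _ => ?_
    rcases Nat.eq_zero_or_pos n with rfl | hn
    · simp
    · have hn' : (n : ℝ) ≠ 0 := by positivity
      simp only [stepKernel, empiricalCDF, ← Finset.mul_sum, Finset.sum_sub_distrib]
      simp
      field_simp
  · exact fun i _ => integrable_mul_of_bounded hp hg hgp (by fun_prop)
      fun t => abs_stepKernel_le_one t _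

/-- By Fubini both means are integrals of `g` against recentred distribution functions; the
recentring `1{0 ≤ x}` cancels in the difference. -/
lemma integral_testFun_sub_sum (hp : 1 ≤ p) (hg : Measurable g)
    (hgp : ∀ x, |g x| ≤ |x| ^ (p - 1)) (P : Measure ℝ) [IsProbabilityMeasure P] {n : ℕ}
    (x : Fin n → ℝ) :
    n * ∫ y, testFun g R y ∂P - ∑ i, testFun g R (x i) =
      n * ∫ t in Set.Icc (-R) R, g t * (cdf P t - empiricalCDF x t) := by
  have hF : Measurable (cdf P) := (monotone_cdf P).measurable
  have hE := measurable_empiricalCDF_right x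
  have hI := measurable_indicator_Iic 0
  rw [integral_testFun hp hg hgp, sum_testFun hp hg hgp, ← mul_sub, ← integral_sub]
  · congr 2; ext t; ring
  · refine integrable_mul_of_bounded hp hg hgp (by fun_prop) fun t => ?_
    have := cdf_nonneg P t
    have := cdf_le_one P t
    rw [abs_le, Set.indicator_apply]
    split_ifs <;> constructor <;> simp <;> linarith
  · refine integrable_mul_of_bounded hp hg hgp (by fun_prop) fun t => ?_
    have := empiricalCDF_mem_Icc x t
    rw [abs_le, Set.indicator_apply]
    split_ifs <;> constructor <;> simp <;> linarith [this.1, this.2]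

end TestFun

/-! ### Truncation and separation from the sample -/

lemma lintegral_compl_Icc_le {P Q : Measure ℝ} [IsProbabilityMeasure P] [IsProbabilityMeasure Q]
    {p δ K R : ℝ} (hp : 1 < p) (hδ : 0 < δ) (hK : 0 ≤ K) (hR : 0 < R)
    (hP : absMoment (2 * p + δ) P ≤ ENNReal.ofReal K)
    (hQ : absMoment (2 * p + δ) Q ≤ ENNReal.ofReal K) :
    ∫⁻ x in (Set.Icc (-R) R)ᶜ, ENNReal.ofReal (|x| ^ (p - 1) * |cdf P x - cdf Q x|) ≤
      ENNReal.ofReal (2 ^ (2 * p + δ) * (1 + K) * R ^ (-p)) *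
        ∫⁻ x : ℝ, ENNReal.ofReal ((1 + |x|) ^ (-(1 + δ / 2))) := by
  rw [← lintegral_const_mul _ (by fun_prop)]
  refine le_trans (setLIntegral_mono' (measurableSet_Icc.compl) fun x hx => ?_)
    (setLIntegral_le_lintegral _ _)
  rw [← ENNReal.ofReal_mul (by positivity)]
  refine ENNReal.ofReal_le_ofReal ?_
  have hx' : R ≤ 1 + |x| := by
    have : R < |x| := by
      by_contra h
      exact hx (abs_le.1 (not_lt.1 h))
    linarith
  calc |x| ^ (p - 1) * |cdf P x - cdf Q x|
      ≤ (1 + |x|) ^ (p - 1) * (2 ^ (2 * p + δ) * (1 + K) * (1 + |x|) ^ (-(2 * p + δ))) := by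
        gcongr
        · linarith
        · exact abs_cdf_sub_cdf_le (by linarith) hK hP hQ x
    _ = 2 ^ (2 * p + δ) * (1 + K) * (1 + |x|) ^ (-p) * (1 + |x|) ^ (-(1 + δ)) := by
        rw [mul_left_comm, ← Real.rpow_add (by positivity), mul_assoc _ ((1 + |x|) ^ (-p)),
          ← Real.rpow_add (by positivity)]
        congr 2; ring
    _ ≤ _ := by
        gcongr ?_ * ?_
        · gcongr ?_ * ?_
          exact Real.rpow_le_rpow_of_nonpos hR hx' (by linarith)
        -- The exponent `1 + δ` is weakened to `1 + δ/2` so that the same integral serves here and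
        -- in the empirical bound.
        · exact Real.rpow_le_rpow_of_exponent_le (by linarith [abs_nonneg x]) (by linarith)

/-- A signed weight attaining the truncated weighted distance between two distribution
functions. -/
noncomputable def signWeight (p : ℝ) (P Q : Measure ℝ) (x : ℝ) : ℝ :=
  |x| ^ (p - 1) * if 0 ≤ cdf P x - cdf Q x then 1 else -1

lemma measurable_signWeight (p : ℝ) (P Q : Measure ℝ) : Measurable (signWeight p P Q) := by
  have hP : Measurable (cdf P) := (monotone_cdf P).measurable
  have hQ : Measurable (cdf Q) := (monotone_cdf Q).measurable
  have hs : Measurable fun x => if 0 ≤ cdf P x - cdf Q x then (1 : ℝ) else -1 :=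
    Measurable.ite (measurableSet_le measurable_const (hP.sub hQ)) measurable_const
      measurable_const
  unfold signWeight
  fun_prop

lemma abs_signWeight_le (p : ℝ) (P Q : Measure ℝ) (x : ℝ) :
    |signWeight p P Q x| ≤ |x| ^ (p - 1) := by
  rw [signWeight, abs_mul, abs_of_nonneg (by positivity : 0 ≤ |x| ^ (p - 1))]
  refine mul_le_of_le_one_right (by positivity) ?_
  split_ifs <;> simp

/-- Split `F_P - F_n = (F_P - F_Q) - (F_n - F_Q)`. The signed weight turns the first part into its
weighted absolute value, at least `a - t` inside the window; the second part costs at most `b`. -/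
lemma le_integral_testFun_sub_sum {P Q : Measure ℝ} [IsProbabilityMeasure P]
    [IsProbabilityMeasure Q] {p R a b t : ℝ} (hp : 1 < p) (hb : 0 ≤ b) (ht : 0 ≤ t)
    {n : ℕ} (x : Fin n → ℝ)
    (hPQ : ENNReal.ofReal a ≤ weightedDist p (cdf P) (cdf Q))
    (htail : ∫⁻ x in (Set.Icc (-R) R)ᶜ, ENNReal.ofReal (|x| ^ (p - 1) * |cdf P x - cdf Q x|) ≤
      ENNReal.ofReal t)
    (hQ : weightedDist p (empiricalCDF x) (cdf Q) ≤ ENNReal.ofReal b) :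
    n * (a - t - b) ≤ n * ∫ y, testFun (signWeight p P Q) R y ∂P -
      ∑ i, testFun (signWeight p P Q) R (x i) := by
  have hFP : Measurable (cdf P) := (monotone_cdf P).measurable
  have hFQ : Measurable (cdf Q) := (monotone_cdf Q).measurable
  have hE := measurable_empiricalCDF_right x
  have hg := measurable_signWeight p P Q
  have hw : ∀ x : ℝ, |(|x| ^ (p - 1))| ≤ |x| ^ (p - 1) := fun x => by
    rw [abs_of_nonneg (by positivity)]
  have hPQ1 : ∀ x, |cdf P x - cdf Q x| ≤ 1 := fun x => by
    rw [abs_le]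
    constructor <;> linarith [cdf_nonneg P x, cdf_le_one P x, cdf_nonneg Q x, cdf_le_one Q x]
  have hEQ1 : ∀ t, |empiricalCDF x t - cdf Q t| ≤ 1 := fun t => by
    have := empiricalCDF_mem_Icc x t
    rw [abs_le]
    constructor <;> linarith [this.1, this.2, cdf_nonneg Q t, cdf_le_one Q t]
  have hEP1 : ∀ t, |cdf P t - empiricalCDF x t| ≤ 1 := fun t => by
    have := empiricalCDF_mem_Icc x t
    rw [abs_le]
    constructor <;> linarith [this.1, this.2, cdf_nonneg P t, cdf_le_one P t]
  have hi1 : IntegrableOn (fun x => |x| ^ (p - 1) * |cdf P x - cdf Q x|) (Set.Icc (-R) R) :=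
    integrable_mul_of_bounded hp.le (by fun_prop) hw (by fun_prop) (by simpa using hPQ1)
  have hi2 : IntegrableOn (fun t => |t| ^ (p - 1) * |empiricalCDF x t - cdf Q t|)
      (Set.Icc (-R) R) :=
    integrable_mul_of_bounded hp.le (by fun_prop) hw (by fun_prop) (by simpa using hEQ1)
  have h1 : a - t ≤ ∫ x in Set.Icc (-R) R, |x| ^ (p - 1) * |cdf P x - cdf Q x| := by
    have h0 : 0 ≤ ∫ x in Set.Icc (-R) R, |x| ^ (p - 1) * |cdf P x - cdf Q x| :=
      integral_nonneg fun x => by positivity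
    rw [sub_le_iff_le_add, ← ENNReal.ofReal_le_ofReal_iff (by positivity),
      ENNReal.ofReal_add h0 ht, ofReal_integral_eq_lintegral_ofReal hi1
        (Eventually.of_forall fun x => by positivity)]
    calc ENNReal.ofReal a ≤ _ := hPQ
      _ = _ := (lintegral_add_compl _ measurableSet_Icc).symm
      _ ≤ _ := by gcongr
  have h2 : ∫ t in Set.Icc (-R) R, |t| ^ (p - 1) * |empiricalCDF x t - cdf Q t| ≤ b := by
    rw [← ENNReal.ofReal_le_ofReal_iff hb, ofReal_integral_eq_lintegral_ofReal hi2
        (Eventually.of_forall fun x => by positivity)]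
    exact (setLIntegral_le_lintegral _ _).trans hQ
  rw [integral_testFun_sub_sum hp.le hg (abs_signWeight_le p P Q)]
  gcongr
  calc a - t - b ≤ _ := by linarith
    _ = ∫ t in Set.Icc (-R) R, (|t| ^ (p - 1) * |cdf P t - cdf Q t| -
        |t| ^ (p - 1) * |empiricalCDF x t - cdf Q t|) := (integral_sub hi1 hi2).symm
    _ ≤ _ := by
        refine integral_mono (hi1.sub hi2) (integrable_mul_of_bounded hp.le hg
          (abs_signWeight_le p P Q) (by fun_prop) hEP1) fun t => ?_
        have e1 : signWeight p P Q t * (cdf P t - cdf Q t) =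
            |t| ^ (p - 1) * |cdf P t - cdf Q t| := by
          rw [signWeight, mul_assoc]
          split_ifs with h
          · rw [one_mul, abs_of_nonneg h]
          · rw [neg_one_mul, abs_of_neg (not_le.1 h)]
        have e2 : -(|t| ^ (p - 1) * |empiricalCDF x t - cdf Q t|) ≤
            -(signWeight p P Q t * (empiricalCDF x t - cdf Q t)) := by
          refine neg_le_neg ((le_abs_self _).trans ?_)
          rw [abs_mul]
          gcongr
          exact abs_signWeight_le p P Q t
        simp only
        linarith

/-! ### Chernoff bound and change of measure -/

/-- Integrate `exp(-s) ≤ 1 - s + s²`, valid for `|s| ≤ 1`, and then use `1 + z ≤ exp z`. -/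
lemma lintegral_exp_neg_mul_le {P : Measure ℝ} [IsProbabilityMeasure P] {h : ℝ → ℝ}
    (hh : Measurable h) {c V : ℝ} (hc : ∀ y, |c * h y| ≤ 1)
    (hV : ∫⁻ y, ENNReal.ofReal ((c * h y) ^ 2) ∂P ≤ ENNReal.ofReal V) (hV0 : 0 ≤ V) :
    ∫⁻ y, ENNReal.ofReal (Real.exp (-(c * h y))) ∂P ≤
      ENNReal.ofReal (Real.exp (-(∫ y, c * h y ∂P) + V)) := by
  have hi : Integrable (fun y => c * h y) P :=
    Integrable.of_bound (by fun_prop) 1 (Eventually.of_forall hc)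
  have hi2 : Integrable (fun y => (c * h y) ^ 2) P :=
    Integrable.of_bound (by fun_prop) 1 (Eventually.of_forall fun y => by
      rw [norm_pow]; exact pow_le_one₀ (norm_nonneg _) (hc y))
  have hi3 : Integrable (fun y => 1 - c * h y + (c * h y) ^ 2) P :=
    ((integrable_const 1).sub hi).add hi2
  have hpt : ∀ y, Real.exp (-(c * h y)) ≤ 1 - c * h y + (c * h y) ^ 2 := fun y => by
    have := Real.abs_exp_sub_one_sub_id_le (x := -(c * h y)) (by rw [abs_neg]; exact hc y)
    have := (abs_le.1 this).2
    nlinarith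
  have hV' : ∫ y, (c * h y) ^ 2 ∂P ≤ V := by
    rw [← ENNReal.ofReal_le_ofReal_iff hV0, ofReal_integral_eq_lintegral_ofReal hi2
      (Eventually.of_forall fun y => sq_nonneg _)]
    exact hV
  calc ∫⁻ y, ENNReal.ofReal (Real.exp (-(c * h y))) ∂P
      ≤ ∫⁻ y, ENNReal.ofReal (1 - c * h y + (c * h y) ^ 2) ∂P :=
        lintegral_mono fun y => ENNReal.ofReal_le_ofReal (hpt y)
    _ = ENNReal.ofReal (∫ y, (1 - c * h y + (c * h y) ^ 2) ∂P) :=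
        (ofReal_integral_eq_lintegral_ofReal hi3 (Eventually.of_forall fun y =>
          (Real.exp_pos _).le.trans (hpt y))).symm
    _ ≤ _ := by
        refine ENNReal.ofReal_le_ofReal ?_
        rw [integral_add (by exact (integrable_const 1).sub hi) hi2, integral_sub (integrable_const 1) hi]
        simp only [integral_const, probReal_univ, smul_eq_mul, mul_one]
        linarith [Real.add_one_le_exp (-(∫ y, c * h y ∂P) + V)]

/-- Only an inequality: where `f₀ = 0` the quotient is `0`, and the mass that `P` puts there is
lost. -/
lemma lintegral_mul_density_ratio_le {P₀ P : Measure ℝ} {f₀ f : ℝ → ℝ≥0}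
    (hf₀ : IsDensity f₀ P₀) (hf : IsDensity f P) {u : ℝ → ℝ≥0∞} (hu : Measurable u) :
    ∫⁻ y, u y * ((f y / f₀ y : ℝ≥0) : ℝ≥0∞) ∂P₀ ≤ ∫⁻ y, u y ∂P := by
  obtain ⟨hm₀, rfl⟩ := hf₀
  obtain ⟨hm, rfl⟩ := hf
  rw [lintegral_withDensity_eq_lintegral_mul _ (by fun_prop) (by fun_prop),
    lintegral_withDensity_eq_lintegral_mul _ (by fun_prop) hu]
  refine lintegral_mono fun y => ?_
  simp only [Pi.mul_apply]
  rw [mul_left_comm, mul_comm (u y), ← ENNReal.coe_mul]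
  gcongr
  rw [mul_comm]
  rcases eq_or_ne (f₀ y) 0 with h | h
  · simp [h]
  · rw [div_mul_cancel₀ _ h]

section Sample

variable {Ω : Type*} [MeasurableSpace Ω] {μ : Measure Ω} {P₀ P : Measure ℝ} {n : ℕ}
  {X : Fin n → Ω → ℝ} {f₀ f : ℝ → ℝ≥0}

lemma lintegral_prod_mul_density_ratio_le (hX : ∀ i, Measurable (X i)) (hindep : iIndepFun X μ)
    (hlaw : ∀ i, μ.map (X i) = P₀) (hf₀ : IsDensity f₀ P₀) (hf : IsDensity f P)
    {u : ℝ → ℝ≥0∞} (hu : Measurable u) :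
    ∫⁻ ω, ∏ i, (u (X i ω) * ((f (X i ω) / f₀ (X i ω) : ℝ≥0) : ℝ≥0∞)) ∂μ ≤
      (∫⁻ y, u y ∂P) ^ n := by
  have hm : Measurable fun y => u y * ((f y / f₀ y : ℝ≥0) : ℝ≥0∞) :=
    hu.mul (hf.1.div hf₀.1).coe_nnreal_ennreal
  rw [lintegral_prod_eq_prod_lintegral_of_indepFun Finset.univ
    (fun i ω => u (X i ω) * ((f (X i ω) / f₀ (X i ω) : ℝ≥0) : ℝ≥0∞))
    (hindep.comp (fun _ y => u y * ((f y / f₀ y : ℝ≥0) : ℝ≥0∞)) fun _ => hm)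
    (fun i => hm.comp (hX i))]
  refine (Finset.prod_le_pow_card _ _ (∫⁻ y, u y ∂P) fun i _ => ?_).trans_eq (by simp)
  rw [← lintegral_map hm (hX i), hlaw i]
  exact lintegral_mul_density_ratio_le hf₀ hf hu

end Sample

/-- The separation constant of the testing argument. -/
noncomputable def sepConst (p δ K : ℝ) : ℝ :=
  2 ^ (2 * p + δ) * (1 + K) * (∫⁻ x : ℝ, ENNReal.ofReal ((1 + |x|) ^ (-(1 + δ / 2)))).toReal +
    2 * (1 + K) + 9

lemma sepConst_pos {p δ K : ℝ} (hK : 0 ≤ K) : 0 < sepConst p δ K := by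
  unfold sepConst; positivity

section Sample

variable {Ω : Type*} [MeasurableSpace Ω] {μ : Measure Ω} {P₀ : Measure ℝ} {n : ℕ}
  {X : Fin n → Ω → ℝ} {f₀ : ℝ → ℝ≥0} {Θ : Type*} {dens : Θ → ℝ → ℝ≥0}

lemma lintegral_sq_mul_testFun_le {P : Measure ℝ} [IsProbabilityMeasure P] {g : ℝ → ℝ}
    {p δ K R e : ℝ} (hp : 1 < p) (hδ : 0 < δ) (hK : 0 ≤ K)
    (hgp : ∀ x, |g x| ≤ |x| ^ (p - 1)) (hP : absMoment (2 * p + δ) P ≤ ENNReal.ofReal K) :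
    ∫⁻ y, ENNReal.ofReal ((e / 2 * testFun g R y) ^ 2) ∂P ≤
      ENNReal.ofReal (e ^ 2 * (1 + K)) := by
  calc ∫⁻ y, ENNReal.ofReal ((e / 2 * testFun g R y) ^ 2) ∂P
      ≤ ∫⁻ y, ENNReal.ofReal (e ^ 2) * (1 + ENNReal.ofReal (|y| ^ (2 * p + δ))) ∂P := by
        refine lintegral_mono fun y => ?_
        rw [← ENNReal.ofReal_one, ← ENNReal.ofReal_add zero_le_one (by positivity),
          ← ENNReal.ofReal_mul (sq_nonneg e)]
        refine ENNReal.ofReal_le_ofReal ?_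
        have h1 := abs_testFun_le_abs_rpow (R := R) hp hgp y
        have h2 : testFun g R y ^ 2 ≤ (2 * |y| ^ p) ^ 2 := sq_le_sq' (abs_le.1 h1).1 (abs_le.1 h1).2
        have h3 : (|y| ^ p) ^ 2 = |y| ^ (2 * p) := by
          rw [← Real.rpow_natCast, ← Real.rpow_mul (abs_nonneg y)]; congr 1; push_cast; ring
        have h4 : |y| ^ (2 * p) ≤ 1 + |y| ^ (2 * p + δ) := by
          rcases le_total |y| 1 with h | h
          · have := Real.rpow_le_one (abs_nonneg y) h (by linarith : 0 ≤ 2 * p)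
            have : 0 ≤ |y| ^ (2 * p + δ) := by positivity
            linarith
          · have := Real.rpow_le_rpow_of_exponent_le h (by linarith : 2 * p ≤ 2 * p + δ)
            linarith
        calc (e / 2 * testFun g R y) ^ 2 = e ^ 2 * (testFun g R y ^ 2 / 4) := by ring
          _ ≤ e ^ 2 * (1 + |y| ^ (2 * p + δ)) := by
            gcongr
            rw [mul_pow, h3] at h2
            linarith
    _ = ENNReal.ofReal (e ^ 2) * (1 + absMoment (2 * p + δ) P) := by
        rw [lintegral_const_mul' _ _ ENNReal.ofReal_ne_top, lintegral_add_left measurable_const]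
        simp [absMoment]
    _ ≤ ENNReal.ofReal (e ^ 2) * (1 + ENNReal.ofReal K) := by gcongr
    _ = _ := by
        rw [ENNReal.ofReal_mul (sq_nonneg e), ENNReal.ofReal_add zero_le_one hK,
          ENNReal.ofReal_one]

/-- The expected likelihood ratio of a separated alternative is exponentially small on the event
that the empirical distribution is close to the true one. -/
lemma lintegral_likelihoodRatio_le [IsProbabilityMeasure P₀] (hX : ∀ i, Measurable (X i))
    (hindep : iIndepFun X μ) (hlaw : ∀ i, μ.map (X i) = P₀) (hf₀ : IsDensity f₀ P₀)
    {θ : Θ} {P : Measure ℝ} [IsProbabilityMeasure P] (hf : IsDensity (dens θ) P)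
    {p δ K e : ℝ} (hp : 1 < p) (hδ : 0 < δ) (hK : 0 ≤ K) (he : 0 < e)
    (hP₀ : absMoment (2 * p + δ) P₀ ≤ ENNReal.ofReal K)
    (hP : absMoment (2 * p + δ) P ≤ ENNReal.ofReal K)
    (hsep : ENNReal.ofReal (sepConst p δ K * e) ≤ weightedDist p (cdf P) (cdf P₀)) :
    ∫⁻ ω in {ω | weightedDist p (empiricalCDF fun i => X i ω) (cdf P₀) ≤ ENNReal.ofReal e},
      (likelihoodRatio f₀ dens (fun i => X i ω) θ : ℝ≥0∞) ∂μ ≤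
      ENNReal.ofReal (Real.exp (-(4 * (n * e ^ 2)))) := by
  -- With `R^p = 1/e`, the test function is bounded by `2/e` and the truncated tail is of order
  -- `R^(-p) = e`.
  set R : ℝ := e ^ (-(1 / p)) with hR
  have hR0 : 0 < R := by positivity
  have hRp : R ^ p = e⁻¹ := by
    rw [hR, ← Real.rpow_mul he.le, neg_mul, one_div_mul_cancel (by linarith), Real.rpow_neg_one]
  have hRnp : R ^ (-p) = e := by rw [Real.rpow_neg hR0.le, hRp, inv_inv]
  set g := signWeight p P P₀
  have hg : Measurable g := measurable_signWeight p P P₀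
  have hgp : ∀ x, |g x| ≤ |x| ^ (p - 1) := abs_signWeight_le p P P₀
  set h := testFun g R
  have hh : Measurable h := measurable_testFun hg
  set m := ∫ y, h y ∂P
  set I := ∫⁻ x : ℝ, ENNReal.ofReal ((1 + |x|) ^ (-(1 + δ / 2))) with hI
  have hI_top : I ≠ ∞ := (lintegral_one_add_abs_rpow_lt_top (by linarith)).ne
  set c := 2 ^ (2 * p + δ) * (1 + K) * I.toReal with hc
  have hc0 : 0 ≤ c := by positivity
  have htail := lintegral_compl_Icc_le hp hδ hK hR0 hP hP₀
  rw [hRnp, ← hI, ← ENNReal.ofReal_toReal hI_top, ← ENNReal.ofReal_mul (by positivity),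
    mul_right_comm, ← hc] at htail
  have hexp : ∫⁻ y, ENNReal.ofReal (Real.exp (-(e / 2 * h y))) ∂P ≤
      ENNReal.ofReal (Real.exp (-(e / 2 * m) + e ^ 2 * (1 + K))) := by
    have := lintegral_exp_neg_mul_le (P := P) hh (c := e / 2) (V := e ^ 2 * (1 + K))
      (fun y => ?_) (lintegral_sq_mul_testFun_le hp hδ hK hgp hP) (by positivity)
    · rwa [integral_const_mul] at this
    · have := abs_testFun_le hp hR0.le hgp y
      rw [abs_mul, abs_of_pos (by positivity : 0 < e / 2)]
      calc e / 2 * |h y| ≤ e / 2 * (2 * R ^ p) := by gcongr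
        _ = 1 := by rw [hRp]; field_simp
  have hum : Measurable fun y => ENNReal.ofReal (Real.exp (-(e / 2 * h y))) := by fun_prop
  -- On the event, `(e/2) ∑ h(X_i) ≤ b`, so the factor `exp(b - (e/2) ∑ h(X_i))` is at least `1` and
  -- may be inserted.
  set b := n * (e / 2 * m) - n * (e ^ 2 * (1 + K + 4)) with hb
  calc _ ≤ ∫⁻ ω, ENNReal.ofReal (Real.exp b) *
        ∏ i, (ENNReal.ofReal (Real.exp (-(e / 2 * h (X i ω)))) *
          ((dens θ (X i ω) / f₀ (X i ω) : ℝ≥0) : ℝ≥0∞)) ∂μ := by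
        have hmD := hf.1
        have hm0 := hf₀.1
        refine (setLIntegral_mono (by fun_prop) fun ω hω => ?_).trans
          (setLIntegral_le_lintegral _ _)
        rw [Finset.prod_mul_distrib, ← mul_assoc, likelihoodRatio, ENNReal.ofNNReal_finsetProd]
        refine le_mul_of_one_le_left (by positivity) ?_
        rw [← ENNReal.ofReal_prod_of_nonneg fun i _ => (Real.exp_pos _).le, ← Real.exp_sum,
          ← ENNReal.ofReal_mul (Real.exp_pos _).le, ← Real.exp_add, ENNReal.one_le_ofReal,
          Real.one_le_exp_iff, Finset.sum_neg_distrib, ← Finset.mul_sum]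
        have := le_integral_testFun_sub_sum (R := R) hp he.le (by positivity)
          (fun i => X i ω) hsep htail hω
        have h2 : e / 2 * (n * (sepConst p δ K * e - c * e - e)) ≤
            e / 2 * (n * m - ∑ i, h (X i ω)) := by gcongr
        -- Of the constant, `c` pays for the truncated tail, `1` for the empirical error and `2(1 +
        -- K)` for the second moment; the remaining `8`, times `e/2`, yields the exponent `4ne²`.
        have h3 : sepConst p δ K = c + 2 * (1 + K) + 9 := rfl
        rw [h3] at h2
        rw [hb]
        linarith
    _ ≤ ENNReal.ofReal (Real.exp b) *
        ENNReal.ofReal (Real.exp (-(e / 2 * m) + e ^ 2 * (1 + K))) ^ n := by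
        rw [lintegral_const_mul' _ _ ENNReal.ofReal_ne_top]
        gcongr
        refine (lintegral_prod_mul_density_ratio_le hX hindep hlaw hf₀ hf hum).trans ?_
        gcongr
    _ = _ := by
        rw [← ENNReal.ofReal_pow (Real.exp_pos _).le, ← Real.exp_nat_mul,
          ← ENNReal.ofReal_mul (Real.exp_pos _).le, ← Real.exp_add, hb]
        congr 2; ring

/-! ### Lower bound for the denominator of the posterior -/

lemma ae_density_pos {P : Measure ℝ} {f : ℝ → ℝ≥0} (hf : IsDensity f P) : ∀ᵐ x ∂P, 0 < f x := by
  obtain ⟨hm, rfl⟩ := hf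
  rw [ae_withDensity_iff hm.coe_nnreal_ennreal]
  exact Eventually.of_forall fun x hx => pos_iff_ne_zero.2 (by simpa using hx)

/-- Chebyshev's inequality for the log-likelihood ratio on a Kullback--Leibler type
neighbourhood. -/
lemma measure_likelihoodRatio_lt_le [IsProbabilityMeasure μ] [IsProbabilityMeasure P₀]
    (hn : 0 < n) (hX : ∀ i, Measurable (X i))
    (hindep : iIndepFun X μ) (hlaw : ∀ i, μ.map (X i) = P₀) (hf₀ : IsDensity f₀ P₀)
    {θ : Θ} (hf : Measurable (dens θ)) {e : ℝ} (he : 0 < e)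
    (hθ : θ ∈ klNeighborhood P₀ f₀ dens e) :
    μ {ω | (likelihoodRatio f₀ dens (fun i => X i ω) θ : ℝ≥0∞) <
        ENNReal.ofReal (Real.exp (-(2 * (n * e ^ 2))))} ≤ ENNReal.ofReal (1 / (n * e ^ 2)) := by
  obtain ⟨hpos, hint, hint2, hmean, hsq⟩ := hθ
  have hn' : (0 : ℝ) < n := by exact_mod_cast hn
  have hm0 := hf₀.1
  set Y : ℝ → ℝ := fun x => Real.log ((f₀ x : ℝ) / dens θ x) with hY
  have hYm : Measurable Y := by fun_prop
  have hY2 : MemLp Y 2 P₀ := (memLp_two_iff_integrable_sq hYm.aestronglyMeasurable).2 hint2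
  have hS : MemLp (fun ω => ∑ i, Y (X i ω)) 2 μ := memLp_finsetSum _ fun i _ => by
    rw [← hlaw i] at hY2
    exact hY2.comp_of_map (hX i).aemeasurable
  have hvar : variance (fun ω => ∑ i, Y (X i ω)) μ ≤ n * e ^ 2 := by
    rw [variance_sum_comp hX hindep hlaw hYm hY2, variance_eq_sub hY2]
    gcongr
    refine le_trans (sub_le_self _ (sq_nonneg _)) hsq
  have hES : ∫ ω, ∑ i, Y (X i ω) ∂μ ≤ n * e ^ 2 := by
    rw [integral_sum_comp hX hlaw hint]
    gcongr
  have hae : ∀ᵐ ω ∂μ, ∀ i, 0 < dens θ (X i ω) ∧ 0 < f₀ (X i ω) := by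
    rw [ae_all_iff]
    intro i
    have : ∀ᵐ x ∂(μ.map (X i)), 0 < dens θ x ∧ 0 < f₀ x := by
      rw [hlaw i]
      exact hpos.and (ae_density_pos hf₀)
    exact ae_of_ae_map (hX i).aemeasurable this
  have hc : 0 < n * e ^ 2 := by positivity
  -- The sum of log ratios has mean and variance at most `ne²`; exceeding `2ne²` is a deviation of
  -- at least `ne²`.
  refine le_trans (measure_mono_ae ?_) ((meas_ge_le_variance_div_sq hS hc).trans ?_)
  · filter_upwards [hae] with ω hω hlt
    have hLR : ((likelihoodRatio f₀ dens (fun i => X i ω) θ : ℝ≥0) : ℝ) =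
        Real.exp (-∑ i, Y (X i ω)) := by
      rw [← Finset.sum_neg_distrib, Real.exp_sum, likelihoodRatio, NNReal.coe_prod]
      refine Finset.prod_congr rfl fun i _ => ?_
      have h1 : (0 : ℝ) < dens θ (X i ω) := (hω i).1
      have h2 : (0 : ℝ) < f₀ (X i ω) := (hω i).2
      rw [hY, ← Real.log_inv, inv_div, Real.exp_log (by positivity), NNReal.coe_div]
    replace hlt : (likelihoodRatio f₀ dens (fun i => X i ω) θ : ℝ≥0∞) <
        ENNReal.ofReal (Real.exp (-(2 * (n * e ^ 2)))) := hlt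
    rw [← ENNReal.ofReal_coe_nnreal, hLR, ENNReal.ofReal_lt_ofReal_iff (Real.exp_pos _),
      Real.exp_lt_exp] at hlt
    change n * e ^ 2 ≤ |∑ i, Y (X i ω) - ∫ ω, ∑ i, Y (X i ω) ∂μ|
    exact le_trans (by linarith) (le_abs_self _)
  · refine ENNReal.ofReal_le_ofReal ?_
    rw [div_le_div_iff₀ (by positivity) hc]
    nlinarith

variable [MeasurableSpace Θ]

lemma measurable_likelihoodRatio (hX : ∀ i, Measurable (X i)) (hf₀ : Measurable f₀)
    (hdens : Measurable (Function.uncurry dens)) :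
    Measurable fun z : Ω × Θ => (likelihoodRatio f₀ dens (fun i => X i z.1) z.2 : ℝ≥0∞) := by
  refine Measurable.coe_nnreal_ennreal (Finset.measurable_prod _ fun i _ => ?_)
  exact (hdens.comp (measurable_snd.prodMk ((hX i).comp measurable_fst))).div
    (hf₀.comp ((hX i).comp measurable_fst))

/-- A lower bound for the denominator of the posterior, which holds with high probability. -/
lemma measure_lintegral_likelihoodRatio_lt_le [IsProbabilityMeasure μ] [IsProbabilityMeasure P₀]
    (hn : 0 < n) (hX : ∀ i, Measurable (X i)) (hindep : iIndepFun X μ)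
    (hlaw : ∀ i, μ.map (X i) = P₀) (hf₀ : IsDensity f₀ P₀)
    (hdens : Measurable (Function.uncurry dens)) (ν : Measure Θ) [IsFiniteMeasure ν]
    {e : ℝ} (he : 0 < e) (hν : ν (klNeighborhood P₀ f₀ dens e) ≠ 0) :
    μ {ω | ∫⁻ θ, (likelihoodRatio f₀ dens (fun i => X i ω) θ : ℝ≥0∞) ∂ν <
        ENNReal.ofReal (Real.exp (-(2 * (n * e ^ 2)))) *
          (ν (klNeighborhood P₀ f₀ dens e) / 2)} ≤ 2 * ENNReal.ofReal (1 / (n * e ^ 2)) := by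
  set A := klNeighborhood P₀ f₀ dens e
  set r := ENNReal.ofReal (Real.exp (-(2 * (n * e ^ 2))))
  set LR : Ω → Θ → ℝ≥0∞ := fun ω θ => likelihoodRatio f₀ dens (fun i => X i ω) θ with hLR
  have hm : Measurable fun z : Ω × Θ => LR z.1 z.2 := measurable_likelihoodRatio hX hf₀.1 hdens
  have hB : MeasurableSet {z : Ω × Θ | LR z.1 z.2 < r} := measurableSet_lt hm measurable_const
  -- `G` is the prior mass of the neighbourhood's parameters with small likelihood ratio. Its mean
  -- is at most `ν A / (ne²)`, so by Markov at least half of `ν A` usually keeps a ratio of at least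
  -- `r`.
  set G : Ω → ℝ≥0∞ := fun ω => ν.restrict A {θ | LR ω θ < r} with hG
  have hGm : Measurable G := measurable_measure_prodMk_left hB
  have hEG : ∫⁻ ω, G ω ∂μ ≤ ENNReal.ofReal (1 / (n * e ^ 2)) * ν A := by
    calc ∫⁻ ω, G ω ∂μ = (μ.prod (ν.restrict A)) {z | LR z.1 z.2 < r} :=
          (Measure.prod_apply hB).symm
      _ = ∫⁻ θ in A, μ {ω | LR ω θ < r} ∂ν := Measure.prod_apply_symm hB
      _ ≤ ∫⁻ _ in A, ENNReal.ofReal (1 / (n * e ^ 2)) ∂ν :=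
          setLIntegral_mono measurable_const fun θ hθ =>
            measure_likelihoodRatio_lt_le hn hX hindep hlaw hf₀
              (hdens.comp measurable_prodMk_left) he hθ
      _ = _ := setLIntegral_const _ _
  have hA : ν A / 2 ≠ 0 := by simp [hν]
  have hA' : ν A / 2 ≠ ∞ := (ENNReal.div_lt_top (measure_ne_top ν A) (by norm_num)).ne
  calc _ ≤ μ {ω | ν A / 2 ≤ G ω} := by
        refine measure_mono fun ω hω => ?_
        by_contra hlt
        replace hlt : G ω < ν A / 2 := not_le.1 hlt
        refine absurd (show ∫⁻ θ, LR ω θ ∂ν < r * (ν A / 2) from hω) (not_lt.2 ?_)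
        have hmω : Measurable (LR ω) := hm.comp measurable_prodMk_left
        have hsplit : ν A ≤ G ω + ν.restrict A {θ | r ≤ LR ω θ} := by
          have := measure_univ_le_add_compl (μ := ν.restrict A) {θ | LR ω θ < r}
          rw [Measure.restrict_apply_univ] at this
          simpa [Set.compl_def, not_lt] using this
        have hhalf : ν A / 2 ≤ ν.restrict A {θ | r ≤ LR ω θ} := by
          by_contra hcon
          refine absurd hsplit (not_le.2 ?_)
          calc _ < ν A / 2 + ν A / 2 := ENNReal.add_lt_add hlt (not_le.1 hcon)
            _ = ν A := ENNReal.add_halves _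
        calc r * (ν A / 2) ≤ r * ν.restrict A {θ | r ≤ LR ω θ} := by gcongr
          _ ≤ ∫⁻ θ in A, LR ω θ ∂ν := mul_meas_ge_le_lintegral hmω r
          _ ≤ _ := setLIntegral_le_lintegral _ _
    _ ≤ (∫⁻ ω, G ω ∂μ) / (ν A / 2) := meas_ge_le_lintegral_div hGm.aemeasurable hA hA'
    _ ≤ _ := by
        refine ENNReal.div_le_of_le_mul (hEG.trans_eq ?_)
        rw [mul_comm 2, mul_assoc, ENNReal.mul_div_cancel (by norm_num) (by norm_num)]

/-- The event is the same for every parameter, so Tonelli reduces the average over the prior to a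
single alternative. -/
lemma lintegral_lintegral_likelihoodRatio_le [SFinite μ] [IsProbabilityMeasure P₀]
    (hX : ∀ i, Measurable (X i)) (hindep : iIndepFun X μ) (hlaw : ∀ i, μ.map (X i) = P₀)
    (hf₀ : IsDensity f₀ P₀) (hdens : Measurable (Function.uncurry dens))
    {Q : Θ → Measure ℝ} [∀ θ, IsProbabilityMeasure (Q θ)] (hf : ∀ θ, IsDensity (dens θ) (Q θ))
    (ν : Measure Θ) [IsProbabilityMeasure ν]
    {p δ K e : ℝ} (hp : 1 < p) (hδ : 0 < δ) (hK : 0 ≤ K) (he : 0 < e)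
    (hP₀ : absMoment (2 * p + δ) P₀ ≤ ENNReal.ofReal K) {A : Set Θ}
    (hA : ∀ θ ∈ A, absMoment (2 * p + δ) (Q θ) ≤ ENNReal.ofReal K ∧
      ENNReal.ofReal (sepConst p δ K * e) ≤ weightedDist p (cdf (Q θ)) (cdf P₀)) :
    ∫⁻ ω in {ω | weightedDist p (empiricalCDF fun i => X i ω) (cdf P₀) ≤ ENNReal.ofReal e},
      ∫⁻ θ in A, (likelihoodRatio f₀ dens (fun i => X i ω) θ : ℝ≥0∞) ∂ν ∂μ ≤
      ENNReal.ofReal (Real.exp (-(4 * (n * e ^ 2)))) := by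
  rw [lintegral_lintegral_swap (measurable_likelihoodRatio hX hf₀.1 hdens).aemeasurable]
  refine (setLIntegral_mono measurable_const fun θ hθ => lintegral_likelihoodRatio_le hX hindep
    hlaw hf₀ (hf θ) hp hδ hK he hP₀ (hA θ hθ).1 (hA θ hθ).2).trans ?_
  rw [setLIntegral_const]
  exact mul_le_of_le_one_right (by positivity) prob_le_one

end Sample

/-! ### Elementary bounds for the posterior -/

section Posterior

variable {Θ : Type*} [MeasurableSpace Θ] {ν : Measure Θ} {f₀ : ℝ → ℝ≥0} {dens : Θ → ℝ → ℝ≥0}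
  {n : ℕ} {x : Fin n → ℝ}

lemma posterior_nonneg (A : Set Θ) : 0 ≤ posterior ν f₀ dens x A := ENNReal.toReal_nonneg

lemma posterior_le_inter_add {A M : Set Θ} (hM : MeasurableSet M) :
    posterior ν f₀ dens x A ≤ posterior ν f₀ dens x (A ∩ M) + (1 - posterior ν f₀ dens x M) := by
  set N : Set Θ → ℝ≥0∞ := fun A => ∫⁻ θ in A, (likelihoodRatio f₀ dens x θ : ℝ≥0∞) ∂ν with hN
  set D : ℝ≥0∞ := ∫⁻ θ, (likelihoodRatio f₀ dens x θ : ℝ≥0∞) ∂ν with hD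
  have hpost : ∀ A, posterior ν f₀ dens x A = (N A / D).toReal := fun A => rfl
  -- This covers degenerate denominators too, since `0 / 0` and `∞ / ∞` are `0` in `ℝ≥0∞`.
  have hle : ∀ A, N A / D ≤ 1 := fun A =>
    (ENNReal.div_le_div_right (setLIntegral_le_lintegral _ _) _).trans ENNReal.div_self_le_one
  have hfin : ∀ A, N A / D ≠ ∞ := fun A => ne_top_of_le_ne_top ENNReal.one_ne_top (hle A)
  have h1 : N A / D ≤ N (A ∩ M) / D + N Mᶜ / D := by
    rw [ENNReal.div_add_div_same]
    gcongr
    refine le_trans (lintegral_mono_set ?_) (lintegral_union_le _ _ _)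
    intro θ hθ
    by_cases h : θ ∈ M
    exacts [Or.inl ⟨hθ, h⟩, Or.inr h]
  have h2 : N M / D + N Mᶜ / D ≤ 1 := by
    rw [ENNReal.div_add_div_same, hN]
    simp only
    rw [lintegral_add_compl _ hM]
    exact ENNReal.div_self_le_one
  have h3 := ENNReal.toReal_mono (ENNReal.add_ne_top.2 ⟨hfin _, hfin _⟩) h1
  have h4 := ENNReal.toReal_mono ENNReal.one_ne_top h2
  rw [ENNReal.toReal_add (hfin _) (hfin _)] at h3 h4
  rw [ENNReal.toReal_one] at h4
  simp only [hpost]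
  linarith

lemma mul_le_of_le_posterior {A : Set Θ} {t : ℝ} {L : ℝ≥0∞}
    (hL : L ≤ ∫⁻ θ, (likelihoodRatio f₀ dens x θ : ℝ≥0∞) ∂ν)
    (ht : t ≤ posterior ν f₀ dens x A) :
    ENNReal.ofReal t * L ≤ ∫⁻ θ in A, (likelihoodRatio f₀ dens x θ : ℝ≥0∞) ∂ν := by
  grw [hL]
  exact ENNReal.mul_le_of_le_div (ENNReal.ofReal_le_of_le_toReal ht)

end Posterior

lemma measurable_absMoment {Θ : Type*} [MeasurableSpace Θ] {dens : Θ → ℝ → ℝ≥0}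
    (hdens : Measurable (Function.uncurry dens)) {Q : Θ → Measure ℝ}
    (hf : ∀ θ, IsDensity (dens θ) (Q θ)) (q : ℝ) : Measurable fun θ => absMoment q (Q θ) := by
  have h : ∀ θ, absMoment q (Q θ) = ∫⁻ x, (dens θ x : ℝ≥0∞) * ENNReal.ofReal (|x| ^ q) := by
    intro θ
    rw [absMoment, (hf θ).2, lintegral_withDensity_eq_lintegral_mul _
      (hf θ).1.coe_nnreal_ennreal (by fun_prop)]
    rfl
  simp only [h]
  have hm : Measurable fun z : Θ × ℝ =>
      ((Function.uncurry dens z : ℝ≥0) : ℝ≥0∞) * ENNReal.ofReal (|z.2| ^ q) := by fun_prop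
  exact hm.lintegral_prod_right'

/-! ### Finite-sample posterior bound -/

section Sample

variable {Ω : Type*} [MeasurableSpace Ω] {μ : Measure Ω} [IsProbabilityMeasure μ]
  {P₀ : Measure ℝ} [IsProbabilityMeasure P₀] {n : ℕ}
  {X : Fin n → Ω → ℝ} {f₀ : ℝ → ℝ≥0} {Θ : Type*} [MeasurableSpace Θ] {dens : Θ → ℝ → ℝ≥0}

lemma measure_weightedDist_empiricalCDF_gt_le (hn : 0 < n)
    (hX : ∀ i, Measurable (X i)) (hindep : iIndepFun X μ) (hlaw : ∀ i, μ.map (X i) = P₀)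
    {p δ K e : ℝ} (hp : 1 < p) (hδ : 0 < δ) (hK : 0 ≤ K) (he : 0 < e)
    (hP₀ : absMoment (2 * p + δ) P₀ ≤ ENNReal.ofReal K) :
    μ {ω | ENNReal.ofReal e < weightedDist p (empiricalCDF fun i => X i ω) (cdf P₀)} ≤
      (ENNReal.ofReal √(2 ^ (2 * p + δ) * (1 + K)) *
        ∫⁻ x : ℝ, ENNReal.ofReal ((1 + |x|) ^ (-(1 + δ / 2)))) *
        ENNReal.ofReal (√(n * e ^ 2))⁻¹ := by
  have hn' : (0 : ℝ) < n := by exact_mod_cast hn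
  refine (measure_mono (Set.ofPred_subset_ofPred.2 fun ω hω => hω.le)).trans ?_
  refine (meas_ge_le_lintegral_div (measurable_weightedDist_empiricalCDF p hX
    (monotone_cdf P₀).measurable).aemeasurable (by simpa using he) ENNReal.ofReal_ne_top).trans ?_
  refine ENNReal.div_le_of_le_mul ?_
  refine (lintegral_weightedDist_empiricalCDF_le hn hX hindep hlaw hp hδ hK hP₀).trans_eq ?_
  rw [mul_assoc _ (ENNReal.ofReal _) (ENNReal.ofReal e), ← ENNReal.ofReal_mul (by positivity),
    mul_right_comm, ← ENNReal.ofReal_mul (by positivity)]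
  congr 2
  rw [Real.sqrt_mul hn'.le, Real.sqrt_sq he.le, Real.sqrt_div' _ hn'.le]
  field_simp

/-- A finite-sample bound for the posterior probability of a separated set. -/
lemma measure_le_posterior_le (hn : 0 < n)
    (hX : ∀ i, Measurable (X i)) (hindep : iIndepFun X μ) (hlaw : ∀ i, μ.map (X i) = P₀)
    (hf₀ : IsDensity f₀ P₀) (hdens : Measurable (Function.uncurry dens))
    {Q : Θ → Measure ℝ} [∀ θ, IsProbabilityMeasure (Q θ)] (hf : ∀ θ, IsDensity (dens θ) (Q θ))
    (ν : Measure Θ) [IsProbabilityMeasure ν]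
    {p δ K e t : ℝ} (hp : 1 < p) (hδ : 0 < δ) (hK : 0 ≤ K) (he : 0 < e) (ht : 0 < t)
    (hP₀ : absMoment (2 * p + δ) P₀ ≤ ENNReal.ofReal K)
    (hν : ENNReal.ofReal (Real.exp (-(n * e ^ 2))) ≤ ν (klNeighborhood P₀ f₀ dens e))
    {A M : Set Θ} (hM : MeasurableSet M)
    (hMK : ∀ θ ∈ M, absMoment (2 * p + δ) (Q θ) ≤ ENNReal.ofReal K)
    (hA : ∀ θ ∈ A, ENNReal.ofReal (sepConst p δ K * e) ≤ weightedDist p (cdf (Q θ)) (cdf P₀)) :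
    μ {ω | t ≤ posterior ν f₀ dens (fun i => X i ω) A} ≤
      μ {ω | t / 2 ≤ ‖posterior ν f₀ dens (fun i => X i ω) M - 1‖} +
      (ENNReal.ofReal √(2 ^ (2 * p + δ) * (1 + K)) *
        ∫⁻ x : ℝ, ENNReal.ofReal ((1 + |x|) ^ (-(1 + δ / 2)))) *
        ENNReal.ofReal (√(n * e ^ 2))⁻¹ +
      2 * ENNReal.ofReal (n * e ^ 2)⁻¹ +
      ENNReal.ofReal (4 / t) * ENNReal.ofReal (Real.exp (-(n * e ^ 2))) := by
  have hν0 : ν (klNeighborhood P₀ f₀ dens e) ≠ 0 :=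
    ((ENNReal.ofReal_pos.2 (Real.exp_pos _)).trans_le hν).ne'
  -- `exp(-2ne²)` comes from the likelihood ratios and `exp(-ne²)/2` from half the prior mass.
  set L : ℝ≥0∞ := ENNReal.ofReal (Real.exp (-(3 * (n * e ^ 2))) / 2) with hL
  have hL' : L ≤ ENNReal.ofReal (Real.exp (-(2 * (n * e ^ 2)))) *
      (ν (klNeighborhood P₀ f₀ dens e) / 2) := by
    grw [← hν]
    rw [← ENNReal.ofReal_ofNat 2, ← ENNReal.ofReal_div_of_pos (by norm_num),
      ← ENNReal.ofReal_mul (by positivity), hL, ← mul_div_assoc, ← Real.exp_add]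
    refine le_of_eq ?_
    congr 3; ring
  set E : Set Ω := {ω | weightedDist p (empiricalCDF fun i => X i ω) (cdf P₀) ≤ ENNReal.ofReal e}
  set num : Ω → ℝ≥0∞ := fun ω =>
    ∫⁻ θ in A ∩ M, (likelihoodRatio f₀ dens (fun i => X i ω) θ : ℝ≥0∞) ∂ν with hnum
  have hnum_meas : Measurable num :=
    (measurable_likelihoodRatio hX hf₀.1 hdens).lintegral_prod_right'
  -- Outside the first three exceptional sets, `A ∩ M` has posterior at least `t/2` with denominator
  -- at least `L`, so the numerator is at least `(t/2) L`. Markov's inequality on `E` then compares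
  -- `exp(-4ne²)` with `exp(-3ne²)`.
  have hsub : {ω | t ≤ posterior ν f₀ dens (fun i => X i ω) A} ⊆
      {ω | t / 2 ≤ ‖posterior ν f₀ dens (fun i => X i ω) M - 1‖} ∪
      {ω | ENNReal.ofReal e < weightedDist p (empiricalCDF fun i => X i ω) (cdf P₀)} ∪
      {ω | ∫⁻ θ, (likelihoodRatio f₀ dens (fun i => X i ω) θ : ℝ≥0∞) ∂ν <
        ENNReal.ofReal (Real.exp (-(2 * (n * e ^ 2)))) *
          (ν (klNeighborhood P₀ f₀ dens e) / 2)} ∪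
      ({ω | ENNReal.ofReal (t / 2) * L ≤ num ω} ∩ E) := by
    intro ω hω
    by_contra hcon
    simp only [Set.mem_union, Set.mem_inter_iff, Set.mem_ofPred_eq, not_or, not_and, not_le,
      not_lt] at hcon hω
    obtain ⟨⟨⟨h1, h2⟩, h3⟩, h4⟩ := hcon
    have h5 := posterior_le_inter_add (ν := ν) (f₀ := f₀) (dens := dens)
      (x := fun i => X i ω) (A := A) hM
    rw [Real.norm_eq_abs, abs_lt] at h1
    have h6 : t / 2 ≤ posterior ν f₀ dens (fun i => X i ω) (A ∩ M) := by linarith [h1.1]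
    exact h4 (mul_le_of_le_posterior (hL'.trans h3) h6) h2
  refine (measure_mono hsub).trans ((measure_union_le _ _).trans (add_le_add
    ((measure_union_le _ _).trans (add_le_add ((measure_union_le _ _).trans
      (add_le_add le_rfl ?_)) ?_)) ?_))
  · exact measure_weightedDist_empiricalCDF_gt_le hn hX hindep hlaw hp hδ hK he hP₀
  · have := measure_lintegral_likelihoodRatio_lt_le hn hX hindep hlaw hf₀ hdens ν he hν0
    rwa [one_div] at this
  · rw [← Measure.restrict_apply (measurableSet_le measurable_const hnum_meas)]
    have hc : ENNReal.ofReal (t / 2) * L = ENNReal.ofReal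
        (t / 2 * (Real.exp (-(3 * (n * e ^ 2))) / 2)) := by
      rw [hL, ← ENNReal.ofReal_mul (by positivity)]
    rw [hc]
    refine (meas_ge_le_lintegral_div hnum_meas.aemeasurable ?_ ENNReal.ofReal_ne_top).trans ?_
    · exact (ENNReal.ofReal_pos.2 (by positivity)).ne'
    · refine ENNReal.div_le_of_le_mul ?_
      refine (lintegral_lintegral_likelihoodRatio_le hX hindep hlaw hf₀ hdens hf ν hp hδ hK he
        hP₀ fun θ hθ => ⟨hMK θ hθ.2, hA θ hθ.1⟩).trans_eq ?_
      rw [← ENNReal.ofReal_mul (by positivity), ← ENNReal.ofReal_mul (by positivity),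
        show -(4 * (n * e ^ 2)) = -(n * e ^ 2) + -(3 * (n * e ^ 2)) by ring, Real.exp_add]
      congr 1
      field_simp
      norm_num

end Sample

/-! ### Passage to the limit -/

lemma tendsto_natCast_mul_sq_atTop {ε : ℕ → ℝ}
    (hε : ∀ n : ℕ, 1 ≤ n → Real.sqrt (Real.log n / n) ≤ ε n) :
    Tendsto (fun n : ℕ => n * ε n ^ 2) atTop atTop := by
  refine tendsto_atTop_mono' _ ?_ (Real.tendsto_log_atTop.comp tendsto_natCast_atTop_atTop)
  filter_upwards [eventually_ge_atTop 1] with n hn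
  have hn' : (0 : ℝ) < n := by exact_mod_cast hn
  have hlog : 0 ≤ Real.log n := Real.log_natCast_nonneg n
  have h := hε n hn
  have h2 : Real.log n / n ≤ ε n ^ 2 := by
    rw [← Real.sq_sqrt (by positivity : 0 ≤ Real.log n / n)]
    gcongr
  simp only [Function.comp_apply]
  rw [div_le_iff₀ hn'] at h2
  linarith

end WassersteinPosterior

theorem mainTheorem1
    -- the i.i.d. observations `X 0, X 1, …` from `P₀`, which has the density `p₀`
    {Ω : Type*} [MeasurableSpace Ω] (μ : Measure Ω) [IsProbabilityMeasure μ]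
    (P₀ : ProbabilityMeasure ℝ) (p₀ : ℝ → ℝ≥0)
    (hp₀ : WassersteinPosterior.IsDensity p₀ (P₀ : Measure ℝ))
    (X : ℕ → Ω → ℝ) (hX : ∀ i, Measurable (X i)) (hindep : iIndepFun X μ)
    (hlaw : ∀ i, μ.map (X i) = (P₀ : Measure ℝ))
    -- the model `𝓕`, a collection of probability measures with (jointly measurable) densities
    (𝓕 : Set (ProbabilityMeasure ℝ)) (dens : 𝓕 → ℝ → ℝ≥0)
    (hdens_meas : Measurable (Function.uncurry dens))
    (hdens : ∀ P : 𝓕, WassersteinPosterior.IsDensity (dens P) ((P : ProbabilityMeasure ℝ) : Measure ℝ))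
    -- the prior, which may depend on the sample size
    (prior : ℕ → Measure 𝓕) [∀ n, IsProbabilityMeasure (prior n)]
    (p : ℝ) (hp : 1 < p)
    -- the rate sequence
    (ε : ℕ → ℝ) (hε_anti : AntitoneOn ε (Set.Ici 1)) (hε_lim : Tendsto ε atTop (𝓝 0))
    (hε_ge : ∀ n : ℕ, 1 ≤ n → Real.sqrt (Real.log n / n) ≤ ε n)
    -- the Kullback--Leibler rate condition on the prior
    (hKL : ∀ᶠ n : ℕ in atTop,
      ENNReal.ofReal (Real.exp (-(n * ε n ^ 2))) ≤
        prior n (WassersteinPosterior.klNeighborhood (P₀ : Measure ℝ) p₀ dens (ε n)))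
    -- the moment conditions on `P₀` and on the posterior
    (K δ : ℝ) (hK : 0 < K) (hδ : 0 < δ)
    (hP₀ : WassersteinPosterior.absMoment (2 * p + δ) (P₀ : Measure ℝ) < ∞)
    (hpost : TendstoInMeasure μ
      (fun n ω => WassersteinPosterior.posterior (prior n) p₀ dens (fun i : Fin n => X i ω)
        {P : 𝓕 | WassersteinPosterior.absMoment (2 * p + δ)
          ((P : ProbabilityMeasure ℝ) : Measure ℝ) ≤ ENNReal.ofReal K})
      atTop (fun _ => 1)) :
    ∃ K' : ℝ, 0 < K' ∧
      TendstoInMeasure μ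
        (fun n ω => WassersteinPosterior.posterior (prior n) p₀ dens (fun i : Fin n => X i ω)
          {P : 𝓕 | ENNReal.ofReal (K' * ε n) ≤
            WassersteinPosterior.wasserstein p ((P : ProbabilityMeasure ℝ) : Measure ℝ)
              (P₀ : Measure ℝ) ^ p})
        atTop (fun _ => 0) := by
  -- One constant that bounds the moments of `P₀` and of the model measures with moment at most `K`.
  set K₁ : ℝ := max K
    (WassersteinPosterior.absMoment (2 * p + δ) (P₀ : Measure ℝ)).toReal with hK₁
  have hK₁0 : 0 ≤ K₁ := hK.le.trans (le_max_left _ _)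
  have hP₀' : WassersteinPosterior.absMoment (2 * p + δ) (P₀ : Measure ℝ) ≤
      ENNReal.ofReal K₁ :=
    (ENNReal.ofReal_toReal hP₀.ne).ge.trans (ENNReal.ofReal_le_ofReal (le_max_right _ _))
  have hD := WassersteinPosterior.sepConst_pos (p := p) (δ := δ) hK₁0
  -- The factor `4^p` is cancelled by the one in `wasserstein_rpow_le`.
  refine ⟨4 ^ p * WassersteinPosterior.sepConst p δ K₁, by positivity, ?_⟩
  rw [tendstoInMeasure_iff_norm] at hpost ⊢
  intro t ht
  have hM : MeasurableSet {P : 𝓕 | WassersteinPosterior.absMoment (2 * p + δ)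
      ((P : ProbabilityMeasure ℝ) : Measure ℝ) ≤ ENNReal.ofReal K} :=
    measurableSet_le (WassersteinPosterior.measurable_absMoment hdens_meas hdens _)
      measurable_const
  have hs := WassersteinPosterior.tendsto_natCast_mul_sq_atTop hε_ge
  have hC : ENNReal.ofReal √(2 ^ (2 * p + δ) * (1 + K₁)) *
      ∫⁻ x : ℝ, ENNReal.ofReal ((1 + |x|) ^ (-(1 + δ / 2))) ≠ ∞ :=
    ENNReal.mul_ne_top ENNReal.ofReal_ne_top
      (WassersteinPosterior.lintegral_one_add_abs_rpow_lt_top (by linarith)).ne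
  have hlim : ∀ {u : ℕ → ℝ} {C : ℝ≥0∞}, C ≠ ∞ → Tendsto u atTop (𝓝 0) →
      Tendsto (fun n => C * ENNReal.ofReal (u n)) atTop (𝓝 0) := fun hC hu => by
    simpa using ENNReal.Tendsto.const_mul (ENNReal.tendsto_ofReal hu) (Or.inr hC)
  have hbound := (((hpost (t / 2) (by positivity)).add (hlim hC (tendsto_inv_atTop_zero.comp
    (Real.tendsto_sqrt_atTop.comp hs)))).add (hlim (C := 2) (by norm_num)
    (tendsto_inv_atTop_zero.comp hs))).add (hlim (C := ENNReal.ofReal (4 / t))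
    ENNReal.ofReal_ne_top (Real.tendsto_exp_neg_atTop_nhds_zero.comp hs))
  simp only [add_zero] at hbound
  refine tendsto_of_tendsto_of_tendsto_of_le_of_le' tendsto_const_nhds hbound
    (Eventually.of_forall fun _ => zero_le) ?_
  -- From `n = 2` on, `log n > 0`, which forces `ε n > 0`.
  filter_upwards [hKL, eventually_ge_atTop 2] with n hn hn2
  have hn1 : (1 : ℝ) < n := by exact_mod_cast hn2
  have he : 0 < ε n := lt_of_lt_of_le
    (Real.sqrt_pos.2 (div_pos (Real.log_pos hn1) (by linarith))) (hε_ge n (by omega))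
  have hmain := WassersteinPosterior.measure_le_posterior_le (n := n) (by omega)
    (X := fun i : Fin n => X i) (fun i => hX i) (hindep.precomp Fin.val_injective)
    (fun i => hlaw i) hp₀ hdens_meas hdens (prior n) hp hδ hK₁0 he ht hP₀' hn hM
    (fun P hP => le_trans hP (ENNReal.ofReal_le_ofReal (le_max_left _ _)))
    (A := {P : 𝓕 | ENNReal.ofReal (4 ^ p * WassersteinPosterior.sepConst p δ K₁ * ε n) ≤
      WassersteinPosterior.wasserstein p ((P : ProbabilityMeasure ℝ) : Measure ℝ)
        (P₀ : Measure ℝ) ^ p})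
    (fun P hP => by
      have h := le_trans hP (WassersteinPosterior.wasserstein_rpow_le hp.le _ _)
      rw [mul_assoc, ENNReal.ofReal_mul (by positivity)] at h
      exact (ENNReal.mul_le_mul_iff_right (ENNReal.ofReal_pos.2 (by positivity)).ne'
        ENNReal.ofReal_ne_top).1 h)
  simp only [sub_zero, Real.norm_of_nonneg (WassersteinPosterior.posterior_nonneg _)]
  exact hmain
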